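/- **Theorem (Stone–von Neumann, abstract version).** Let $G$ be a second countable, locally compact, Hausdorff group that is unimodular, and fix a (left) Haar measure $ds$ on $G$. Let $G$ act on $C_0(G)$ by $\alpha_s(\varphi)(x)=\varphi(s^{-1}x)$. Let $C_0(G)\rtimes_\alpha G$ be the (full) crossed product, i.e. the enveloping $C^*$-algebra of the $*$-algebra $C_c(G,C_0(G))$ with $$(F*H)(s)=\int_G F(t)\,\alpha_t\big(H(t^{-1}s)\big)\,dt,\qquad F^*(s)=\Delta(s^{-1})\,\alpha_s\big(F(s^{-1})^*\big)$$ ($\Delta$ the modular function, here $\Delta=1$): the completion with respect to $\|F\|=\sup_\pi\|\pi(F)\|$, where $\pi$ runs over the $*$-representations of $C_c(G,C_0(G))$ on Hilbert spaces with $\|\pi(F)\|\le\int_G\|F(s)\|\,ds$ for all $F$. Identify $K\in C_c(G\times G)$ with the element $s\mapsto K(\cdot,s)$ of $C_c(G,C_0(G))$ and with its image in $C_0(G)\rtimes_\alpha G$. Then $C_0(G)\rtimes_\alpha G$ is $*$-isomorphic to the $C^*$-algebra $\mathcal K(L^2(G))$ of compact operators on $L^2(G)$. More precisely, for $f,g\in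 C_c(G)$ let $$\widetilde\theta_{f,g}(x,s)=f(x)\,\overline{g(s^{-1}x)},\qquad \widetilde\theta_{f,g}\in C_c(G\times G).$$ Then, in $C_0(G)\rtimes_\alpha G$: 1. $\widetilde\theta_{f_1,g_1}\widetilde\theta_{f_2,g_2}=\langle f_2|g_1\rangle\,\widetilde\theta_{f_1,g_2}$ for all $f_1,g_1,f_2,g_2\in C_c(G)$, where $\langle f_2|g_1\rangle=\int_G f_2(x)\overline{g_1(x)}\,dx$; 2. $\widetilde\theta_{f,g}^{\,*}=\widetilde\theta_{g,f}$ for all $f,g\in C_c(G)$; 3. the linear span of $\{\widetilde\theta_{f,g}: f,g\in C_c(G)\}$ is dense in $C_0(G)\rtimes_\alpha G$; 4. there is a $*$-isomorphism $\Phi:C_0(G)\rtimes_\alpha G\to\mathcal K(L^2(G))$ with $\Phi(\widetilde\theta_{f,g})=\theta_{f,g}$ for all $f,g\in C_c(G)$, where $\theta_{f,g}(\xi)=\langle\xi|g\rangle f$ is the rank-one operator on $L^2(G)$. -/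

import Mathlib

open MeasureTheory Filter Topology
open scoped NNReal ENNReal CompactlySupported ZeroAtInfty ComplexConjugate

universe u v

noncomputable section

/-! ### The modular function -/

section Modular

variable {G : Type u} [Group G] [TopologicalSpace G] [IsTopologicalGroup G] [LocallyCompactSpace G]

/-- The modular function `Δ` of a locally compact group: if `μ` is a left Haar measure, then
`∫ f (t * s⁻¹) ∂μ(t) = Δ s * ∫ f ∂μ` for compactly supported continuous `f`. Mathlib's
`modularCharacterFun` is normalised by `∫ f (t * s) ∂μ(t) = modularCharacterFun s * ∫ f ∂μ`. -/
def modularFunction (s : G) : ℝ :=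
  (Measure.modularCharacterFun s⁻¹ : ℝ≥0)

variable (G) in
/-- `G` is unimodular if its modular function is identically `1`. -/
def IsUnimodular : Prop := ∀ s : G, modularFunction s = 1

open scoped Pointwise in
theorem continuous_modularFunction : Continuous (modularFunction : G → ℝ) := by
  borelize G
  let ν : Measure G := Measure.haar
  obtain ⟨⟨f, f_cont⟩, f_comp, f_nonneg, f_one⟩ :
    ∃ f : C(G, ℝ), HasCompactSupport f ∧ 0 ≤ f ∧ f 1 ≠ 0 := exists_continuous_nonneg_pos 1
  have hf0 : ∫ x, f x ∂ν ≠ 0 :=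
    ne_of_gt (f_cont.integral_pos_of_hasCompactSupport_nonneg_nonzero f_comp f_nonneg f_one)
  have key : ∀ s : G, modularFunction s = (∫ x, f (x * s⁻¹) ∂ν) / ∫ x, f x ∂ν := by
    intro s
    rw [modularFunction, Measure.modularCharacterFun_eq_haarScalarFactor ν,
      Measure.haarScalarFactor_eq_integral_div _ _ f_cont f_comp hf0,
      integral_map (AEMeasurable.mul_const aemeasurable_id' _)
        (Continuous.aestronglyMeasurable f_cont)]
  simp_rw [funext key]
  refine Continuous.div_const ?_ _
  rw [continuous_iff_continuousAt]
  intro s₀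
  obtain ⟨N, hN, hNs⟩ := exists_compact_mem_nhds s₀
  refine ContinuousOn.continuousAt (s := N) ?_ hNs
  refine continuousOn_integral_of_compact_support (k := tsupport f * N)
    (IsCompact.mul f_comp hN) (by fun_prop) ?_
  intro s x hs hx
  refine image_eq_zero_of_notMem_tsupport fun h => hx ?_
  exact ⟨x * s⁻¹, h, s, hs, by simp⟩

end Modular

/-! ### Dynamical systems -/

/-- An action of the topological group `G` on the C⋆-algebra `A` by ⋆-automorphisms, continuous for
the norm topology at every element of `A`. -/
structure CStarAction (G : Type u) (A : Type v) [Group G] [TopologicalSpace G]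
    [NonUnitalCStarAlgebra A] where
  /-- the automorphism `α_s` -/
  aut : G → (A ≃⋆ₐ[ℂ] A)
  aut_mul : ∀ (s t : G) (a : A), aut (s * t) a = aut s (aut t a)
  continuous_aut : ∀ a : A, Continuous fun s => aut s a

namespace CStarAction

variable {G : Type u} {A : Type v} [Group G] [TopologicalSpace G] [NonUnitalCStarAlgebra A]

theorem norm_aut (α : CStarAction G A) (s : G) (a : A) : ‖α.aut s a‖ = ‖a‖ :=
  NonUnitalStarAlgHom.norm_map (α.aut s) (α.aut s).injective a

theorem continuous_uncurry (α : CStarAction G A) : Continuous fun p : G × A => α.aut p.1 p.2 := by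
  rw [continuous_iff_continuousAt]
  rintro ⟨s₀, a₀⟩
  rw [ContinuousAt, tendsto_iff_norm_sub_tendsto_zero]
  have h1 : Tendsto (fun p : G × A => ‖p.2 - a₀‖ + ‖α.aut p.1 a₀ - α.aut s₀ a₀‖)
      (𝓝 (s₀, a₀)) (𝓝 0) := by
    have hc := α.continuous_aut a₀
    have : Continuous fun p : G × A => ‖p.2 - a₀‖ + ‖α.aut p.1 a₀ - α.aut s₀ a₀‖ := by fun_prop
    simpa using this.tendsto (s₀, a₀)
  refine squeeze_zero (fun _ => norm_nonneg _) (fun p => ?_) h1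
  calc ‖α.aut p.1 p.2 - α.aut s₀ a₀‖
      = ‖α.aut p.1 (p.2 - a₀) + (α.aut p.1 a₀ - α.aut s₀ a₀)‖ := by rw [map_sub]; abel_nf
    _ ≤ ‖α.aut p.1 (p.2 - a₀)‖ + ‖α.aut p.1 a₀ - α.aut s₀ a₀‖ := norm_add_le _ _
    _ = _ := by rw [norm_aut]

end CStarAction

/-! ### The convolution algebra -/

/-- The vector space `C_c(G, A)` of compactly supported continuous functions, to be equipped with
the convolution and the involution determined by the action `α` and the Haar measure `μ`. -/
def ConvAlg {G : Type u} {A : Type v} [Group G] [TopologicalSpace G] [NonUnitalCStarAlgebra A]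
    [MeasurableSpace G] (_α : CStarAction G A) (_μ : Measure G) : Type (max u v) :=
  C_c(G, A)

namespace ConvAlg

variable {G : Type u} {A : Type v} [Group G] [TopologicalSpace G] [NonUnitalCStarAlgebra A]
  [MeasurableSpace G] {α : CStarAction G A} {μ : Measure G}

instance : FunLike (ConvAlg α μ) G A := inferInstanceAs (FunLike C_c(G, A) G A)

instance : AddCommGroup (ConvAlg α μ) := inferInstanceAs (AddCommGroup C_c(G, A))

instance : Module ℂ (ConvAlg α μ) := inferInstanceAs (Module ℂ C_c(G, A))

/-- The element of the convolution algebra given by a continuous function of compact support. -/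
def mk (f : G → A) (hf : Continuous f) (hf' : HasCompactSupport f) : ConvAlg α μ :=
  (⟨⟨f, hf⟩, hf'⟩ : C_c(G, A))

@[simp] theorem mk_apply (f : G → A) (hf : Continuous f) (hf' : HasCompactSupport f) (s : G) :
    (mk f hf hf' : ConvAlg α μ) s = f s := rfl

@[ext] theorem ext {f g : ConvAlg α μ} (h : ∀ s, f s = g s) : f = g := DFunLike.ext _ _ h

protected theorem continuous (f : ConvAlg α μ) : Continuous f :=
  map_continuous (show C_c(G, A) from f)

protected theorem hasCompactSupport (f : ConvAlg α μ) : HasCompactSupport f :=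
  CompactlySupportedContinuousMap.hasCompactSupport (f : C_c(G, A))

@[simp] theorem zero_apply (s : G) : (0 : ConvAlg α μ) s = 0 := rfl
@[simp] theorem add_apply (f g : ConvAlg α μ) (s : G) : (f + g) s = f s + g s := rfl
@[simp] theorem neg_apply (f : ConvAlg α μ) (s : G) : (-f) s = -f s := rfl
@[simp] theorem smul_apply (c : ℂ) (f : ConvAlg α μ) (s : G) : (c • f) s = c • f s := rfl

theorem hasCompactSupport_integrand (f g : ConvAlg α μ) (s : G) :
    HasCompactSupport fun t => f t * α.aut t (g (t⁻¹ * s)) :=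
  f.hasCompactSupport.mul_right

variable [IsTopologicalGroup G]

theorem continuous_integrand (f g : ConvAlg α μ) :
    Continuous fun p : G × G => f p.2 * α.aut p.2 (g (p.2⁻¹ * p.1)) := by
  have hf := f.continuous
  have hg := g.continuous
  have := α.continuous_uncurry.comp
    (show Continuous fun p : G × G => (p.2, g (p.2⁻¹ * p.1)) by fun_prop)
  exact (hf.comp continuous_snd).mul this

open scoped Pointwise in
theorem hasCompactSupport_conv (f g : ConvAlg α μ) :
    HasCompactSupport fun s => ∫ t, f t * α.aut t (g (t⁻¹ * s)) ∂μ := by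
  have hK : IsCompact (tsupport f * tsupport g) :=
    IsCompact.mul f.hasCompactSupport g.hasCompactSupport
  refine HasCompactSupport.of_support_subset_isCompact hK ?_
  intro s hs
  by_contra hsK
  refine hs ?_
  have : ∀ t, f t * α.aut t (g (t⁻¹ * s)) = 0 := by
    intro t
    by_cases ht : t ∈ tsupport f
    · have : t⁻¹ * s ∉ tsupport g := fun h => hsK ⟨t, ht, _, h, by simp⟩
      rw [image_eq_zero_of_notMem_tsupport this, map_zero, mul_zero]
    · rw [image_eq_zero_of_notMem_tsupport ht, zero_mul]
  simp [this]

section Involution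

variable [LocallyCompactSpace G]

theorem continuous_star_fun (f : ConvAlg α μ) :
    Continuous fun s => ((modularFunction s⁻¹ : ℝ) : ℂ) • α.aut s (star (f s⁻¹)) := by
  have hf := f.continuous
  have h1 := α.continuous_uncurry.comp
    (show Continuous fun s : G => (s, star (f s⁻¹)) by fun_prop)
  have h2 : Continuous fun s : G => ((modularFunction s⁻¹ : ℝ) : ℂ) :=
    Complex.continuous_ofReal.comp (continuous_modularFunction.comp continuous_inv)
  exact h2.smul h1

theorem hasCompactSupport_star_fun (f : ConvAlg α μ) :
    HasCompactSupport fun s => ((modularFunction s⁻¹ : ℝ) : ℂ) • α.aut s (star (f s⁻¹)) := by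
  refine HasCompactSupport.of_support_subset_isCompact (K := (fun s : G => s⁻¹) '' tsupport f)
    (f.hasCompactSupport.isCompact.image continuous_inv) ?_
  intro s hs
  refine ⟨s⁻¹, ?_, inv_inv s⟩
  by_contra h
  refine hs ?_
  simp [image_eq_zero_of_notMem_tsupport h]

/-- Involution: `f⋆ s = Δ(s⁻¹) α_s ((f s⁻¹)⋆)`. -/
instance : Star (ConvAlg α μ) where
  star f := mk (fun s => ((modularFunction s⁻¹ : ℝ) : ℂ) • α.aut s (star (f s⁻¹)))
    (continuous_star_fun f) (hasCompactSupport_star_fun f)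

theorem star_apply (f : ConvAlg α μ) (s : G) :
    (star f) s = ((modularFunction s⁻¹ : ℝ) : ℂ) • α.aut s (star (f s⁻¹)) := rfl

end Involution

section Convolution

variable [BorelSpace G] [IsFiniteMeasureOnCompacts μ]

theorem integrable_integrand (f g : ConvAlg α μ) (s : G) :
    Integrable (fun t => f t * α.aut t (g (t⁻¹ * s))) μ :=
  ((continuous_integrand f g).comp (by fun_prop : Continuous fun t : G => (s, t)))
    |>.integrable_of_hasCompactSupport (hasCompactSupport_integrand f g s)

theorem continuous_conv (f g : ConvAlg α μ) :
    Continuous fun s => ∫ t, f t * α.aut t (g (t⁻¹ * s)) ∂μ := by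
  rw [← continuousOn_univ]
  refine continuousOn_integral_of_compact_support (k := tsupport f) f.hasCompactSupport
    (continuous_integrand f g).continuousOn ?_
  intro s t _ ht
  rw [image_eq_zero_of_notMem_tsupport ht, zero_mul]

/-- Convolution: `(f * g) s = ∫ f t * α_t (g (t⁻¹ s)) dt`. -/
instance : Mul (ConvAlg α μ) where
  mul f g := mk (fun s => ∫ t, f t * α.aut t (g (t⁻¹ * s)) ∂μ)
    (continuous_conv f g) (hasCompactSupport_conv f g)

theorem mul_apply (f g : ConvAlg α μ) (s : G) :
    (f * g) s = ∫ t, f t * α.aut t (g (t⁻¹ * s)) ∂μ := rfl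

instance : NonUnitalNonAssocRing (ConvAlg α μ) :=
  { (inferInstance : AddCommGroup (ConvAlg α μ)), (inferInstance : Mul (ConvAlg α μ)) with
    left_distrib := fun f g h => by
      ext s
      simp only [mul_apply, add_apply, map_add, mul_add]
      exact integral_add (integrable_integrand f g s) (integrable_integrand f h s)
    right_distrib := fun f g h => by
      ext s
      simp only [mul_apply, add_apply, add_mul]
      exact integral_add (integrable_integrand f h s) (integrable_integrand g h s)
    zero_mul := fun f => by ext s; simp [mul_apply]
    mul_zero := fun f => by ext s; simp [mul_apply] }

end Convolution

/-- The norm `‖f‖₁ = ∫ ‖f s‖ ds`. -/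
def norm₁ (f : ConvAlg α μ) : ℝ := ∫ s, ‖f s‖ ∂μ

end ConvAlg

/-! ### The enveloping C⋆-algebra -/

section Envelope

variable {G : Type u} {A : Type v} [Group G] [TopologicalSpace G] [IsTopologicalGroup G]
  [LocallyCompactSpace G] [NonUnitalCStarAlgebra A] [MeasurableSpace G] [BorelSpace G]

/-- A ⋆-representation `π` of `C_c(G, A)` by bounded operators on a Hilbert space such that
`‖π f‖ ≤ ‖f‖₁` for all `f`. -/
structure BoundedRep (α : CStarAction G A) (μ : Measure G) [IsFiniteMeasureOnCompacts μ] where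
  /-- the Hilbert space of the representation -/
  H : Type (max u v)
  [normedAddCommGroup : NormedAddCommGroup H]
  [innerProductSpace : InnerProductSpace ℂ H]
  [completeSpace : CompleteSpace H]
  /-- the representation -/
  hom : ConvAlg α μ →⋆ₙₐ[ℂ] (H →L[ℂ] H)
  norm_hom_le : ∀ f, ‖hom f‖ ≤ f.norm₁

attribute [instance] BoundedRep.normedAddCommGroup BoundedRep.innerProductSpace
  BoundedRep.completeSpace

variable {α : CStarAction G A} {μ : Measure G} [IsFiniteMeasureOnCompacts μ]

instance : Nonempty (BoundedRep α μ) :=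
  ⟨{ H := PUnit
     hom :=
      { toFun := fun _ => 0
        map_smul' := fun _ _ => by simp
        map_zero' := rfl
        map_add' := fun _ _ => by simp
        map_mul' := fun _ _ => by simp
        map_star' := fun _ => by simp }
     norm_hom_le := fun f => norm_zero.trans_le (integral_nonneg fun s => norm_nonneg (f s)) }⟩

namespace ConvAlg

/-- The universal norm `‖f‖ = sup {‖π f‖ : π a bounded ⋆-representation}`. -/
def univNorm (f : ConvAlg α μ) : ℝ := ⨆ π : BoundedRep α μ, ‖π.hom f‖

theorem bddAbove_norm_hom (f : ConvAlg α μ) :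
    BddAbove (Set.range fun π : BoundedRep α μ => ‖π.hom f‖) :=
  ⟨f.norm₁, by rintro _ ⟨π, rfl⟩; exact π.norm_hom_le f⟩

theorem norm_hom_le_univNorm (π : BoundedRep α μ) (f : ConvAlg α μ) : ‖π.hom f‖ ≤ f.univNorm :=
  le_ciSup (bddAbove_norm_hom f) π

theorem univNorm_le {f : ConvAlg α μ} {c : ℝ} (h : ∀ π : BoundedRep α μ, ‖π.hom f‖ ≤ c) :
    f.univNorm ≤ c :=
  ciSup_le h

theorem univNorm_nonneg (f : ConvAlg α μ) : 0 ≤ f.univNorm :=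
  Real.iSup_nonneg fun _ => norm_nonneg _

/-- The universal norm as a seminorm of additive groups. -/
def univSeminorm (α : CStarAction G A) (μ : Measure G) [IsFiniteMeasureOnCompacts μ] :
    AddGroupSeminorm (ConvAlg α μ) where
  toFun := univNorm
  map_zero' := le_antisymm (univNorm_le fun π => by simp) (univNorm_nonneg _)
  add_le' f g := univNorm_le fun π => by
    rw [map_add]
    exact (norm_add_le _ _).trans
      (add_le_add (norm_hom_le_univNorm π f) (norm_hom_le_univNorm π g))
  neg' f := by simp [univNorm]

instance : SeminormedAddCommGroup (ConvAlg α μ) :=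
  (univSeminorm α μ).toSeminormedAddCommGroup

theorem norm_eq_univNorm (f : ConvAlg α μ) : ‖f‖ = f.univNorm := rfl

theorem norm_hom_le_norm (π : BoundedRep α μ) (f : ConvAlg α μ) : ‖π.hom f‖ ≤ ‖f‖ :=
  norm_hom_le_univNorm π f

theorem norm_le_of_forall {f : ConvAlg α μ} {c : ℝ} (h : ∀ π : BoundedRep α μ, ‖π.hom f‖ ≤ c) :
    ‖f‖ ≤ c :=
  univNorm_le h

instance : NormedSpace ℂ (ConvAlg α μ) where
  norm_smul_le c f := norm_le_of_forall fun π => by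
    rw [map_smul, norm_smul]
    exact mul_le_mul_of_nonneg_left (norm_hom_le_norm π f) (norm_nonneg c)

theorem norm_mul_le' (f g : ConvAlg α μ) : ‖f * g‖ ≤ ‖f‖ * ‖g‖ := norm_le_of_forall fun π => by
  rw [map_mul]
  exact (norm_mul_le _ _).trans (mul_le_mul (norm_hom_le_norm π f) (norm_hom_le_norm π g)
    (norm_nonneg _) (norm_nonneg _))

theorem norm_star_le (f : ConvAlg α μ) : ‖star f‖ ≤ ‖f‖ := norm_le_of_forall fun π => by
  rw [map_star, norm_star]
  exact norm_hom_le_norm π f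

theorem norm_mul_self_le (f : ConvAlg α μ) : ‖f‖ * ‖f‖ ≤ ‖star f * f‖ := by
  have h : ‖f‖ ≤ Real.sqrt ‖star f * f‖ := norm_le_of_forall fun π => by
    refine Real.le_sqrt_of_sq_le ?_
    rw [sq, ← CStarRing.norm_star_mul_self, ← map_star, ← map_mul]
    exact norm_hom_le_norm π _
  calc ‖f‖ * ‖f‖ ≤ Real.sqrt ‖star f * f‖ * Real.sqrt ‖star f * f‖ :=
        mul_self_le_mul_self (norm_nonneg _) h
    _ = _ := Real.mul_self_sqrt (norm_nonneg _)

theorem coe_eq_coe {f g : ConvAlg α μ} (h : ∀ π : BoundedRep α μ, π.hom f = π.hom g) :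
    (f : UniformSpace.Completion (ConvAlg α μ)) = g := by
  rw [← sub_eq_zero, ← UniformSpace.Completion.coe_sub, ← norm_eq_zero,
    UniformSpace.Completion.norm_coe]
  exact le_antisymm (norm_le_of_forall fun π => by simp [h π]) (norm_nonneg _)

end ConvAlg

/-- The (full) crossed product `A ⋊_α G`: the enveloping C⋆-algebra of `C_c(G, A)`, i.e. the
Hausdorff completion of the convolution algebra for the universal norm. -/
abbrev CrossedProduct (α : CStarAction G A) (μ : Measure G) [IsFiniteMeasureOnCompacts μ] :
    Type (max u v) :=
  UniformSpace.Completion (ConvAlg α μ)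

namespace CrossedProduct

open UniformSpace ConvAlg

/-- Convolution as a biadditive map into the completion. -/
def mulHom (α : CStarAction G A) (μ : Measure G) [IsFiniteMeasureOnCompacts μ] :
    ConvAlg α μ →+ ConvAlg α μ →+ CrossedProduct α μ :=
  (AddMonoidHom.mul : ConvAlg α μ →+ ConvAlg α μ →+ ConvAlg α μ).compr₂ Completion.toCompl

theorem mulHom_apply (f g : ConvAlg α μ) :
    mulHom α μ f g = ((f * g : ConvAlg α μ) : CrossedProduct α μ) := rfl

theorem norm_mulHom_le (f g : ConvAlg α μ) : ‖mulHom α μ f g‖ ≤ ‖f‖ * ‖g‖ := by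
  rw [mulHom_apply, Completion.norm_coe]
  exact norm_mul_le' f g

theorem continuous_mulHom :
    Continuous fun p : ConvAlg α μ × ConvAlg α μ => mulHom α μ p.1 p.2 := by
  rw [continuous_iff_continuousAt]
  intro p
  rw [ContinuousAt, tendsto_iff_norm_sub_tendsto_zero]
  have h : Tendsto (fun q : ConvAlg α μ × ConvAlg α μ =>
      ‖q.1 - p.1‖ * ‖q.2‖ + ‖p.1‖ * ‖q.2 - p.2‖) (𝓝 p) (𝓝 0) := by
    have h : Continuous fun q : ConvAlg α μ × ConvAlg α μ =>
      ‖q.1 - p.1‖ * ‖q.2‖ + ‖p.1‖ * ‖q.2 - p.2‖ := by fun_prop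
    simpa using h.tendsto p
  refine squeeze_zero (fun _ => norm_nonneg _) (fun q => ?_) h
  have e : mulHom α μ q.1 q.2 - mulHom α μ p.1 p.2
      = mulHom α μ (q.1 - p.1) q.2 + mulHom α μ p.1 (q.2 - p.2) := by
    simp only [map_sub, AddMonoidHom.sub_apply]
    abel
  rw [e]
  exact (norm_add_le _ _).trans (add_le_add (norm_mulHom_le _ _) (norm_mulHom_le _ _))

/-- The product of the crossed product, extending convolution by continuity. -/
instance : Mul (CrossedProduct α μ) where
  mul := Function.curry <|
    (Completion.isDenseInducing_coe.prodMap Completion.isDenseInducing_coe).extend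
      fun p : ConvAlg α μ × ConvAlg α μ => mulHom α μ p.1 p.2

theorem coe_mul (f g : ConvAlg α μ) :
    ((f * g : ConvAlg α μ) : CrossedProduct α μ) = (f : CrossedProduct α μ) * g :=
  ((Completion.isDenseInducing_coe.prodMap Completion.isDenseInducing_coe).extend_eq
    (continuous_mulHom (α := α) (μ := μ)) (f, g)).symm

instance : ContinuousMul (CrossedProduct α μ) where
  continuous_mul := by
    have di : IsDenseInducing (Completion.toCompl : ConvAlg α μ → CrossedProduct α μ) :=
      Completion.isDenseInducing_coe
    exact (di.extend_Z_bilin di (continuous_mulHom (α := α) (μ := μ)) :)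

theorem uniformContinuous_star : UniformContinuous (star : ConvAlg α μ → ConvAlg α μ) := by
  refine LipschitzWith.uniformContinuous (K := 1) (LipschitzWith.of_dist_le_mul fun f g => ?_)
  rw [dist_eq_norm, dist_eq_norm, NNReal.coe_one, one_mul]
  refine norm_le_of_forall fun π => ?_
  rw [map_sub, map_star, map_star, ← star_sub, norm_star, ← map_sub]
  exact norm_hom_le_norm π _

/-- The involution of the crossed product, extending that of `C_c(G, A)` by continuity. -/
instance : Star (CrossedProduct α μ) where
  star := Completion.map star

theorem coe_star (f : ConvAlg α μ) :
    ((star f : ConvAlg α μ) : CrossedProduct α μ) = star (f : CrossedProduct α μ) :=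
  (Completion.map_coe uniformContinuous_star f).symm

instance : ContinuousStar (CrossedProduct α μ) where
  continuous_star := Completion.continuous_map

instance : NonUnitalRing (CrossedProduct α μ) :=
  { (inferInstance : AddCommGroup (CrossedProduct α μ)),
    (inferInstance : Mul (CrossedProduct α μ)) with
    left_distrib := fun a b c => by
      induction a, b, c using Completion.induction_on₃ with
      | hp => exact isClosed_eq (by fun_prop) (by fun_prop)
      | ih f g h =>
        simp only [← coe_mul, ← Completion.coe_add]
        exact coe_eq_coe fun π => by simp [mul_add]
    right_distrib := fun a b c => by
      induction a, b, c using Completion.induction_on₃ with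
      | hp => exact isClosed_eq (by fun_prop) (by fun_prop)
      | ih f g h =>
        simp only [← coe_mul, ← Completion.coe_add]
        exact coe_eq_coe fun π => by simp [add_mul]
    zero_mul := fun a => by
      induction a using Completion.induction_on with
      | hp => exact isClosed_eq (by fun_prop) (by fun_prop)
      | ih f =>
        simp only [← Completion.coe_zero, ← coe_mul]
        exact coe_eq_coe fun π => by simp
    mul_zero := fun a => by
      induction a using Completion.induction_on with
      | hp => exact isClosed_eq (by fun_prop) (by fun_prop)
      | ih f =>
        simp only [← Completion.coe_zero, ← coe_mul]
        exact coe_eq_coe fun π => by simp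
    mul_assoc := fun a b c => by
      induction a, b, c using Completion.induction_on₃ with
      | hp => exact isClosed_eq (by fun_prop) (by fun_prop)
      | ih f g h =>
        simp only [← coe_mul]
        exact coe_eq_coe fun π => by simp [mul_assoc] }

instance : NonUnitalNormedRing (CrossedProduct α μ) :=
  { (inferInstance : NormedAddCommGroup (CrossedProduct α μ)),
    (inferInstance : NonUnitalRing (CrossedProduct α μ)) with
    norm_mul_le := fun a b => by
      induction a, b using Completion.induction_on₂ with
      | hp => exact isClosed_le (by fun_prop) (by fun_prop)
      | ih f g =>
        simp only [← coe_mul, Completion.norm_coe]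
        exact norm_mul_le' f g }

instance : StarRing (CrossedProduct α μ) where
  star_involutive a := by
    induction a using Completion.induction_on with
    | hp => exact isClosed_eq (by fun_prop) (by fun_prop)
    | ih f =>
      simp only [← coe_star]
      exact coe_eq_coe fun π => by simp only [map_star, star_star]
  star_mul a b := by
    induction a, b using Completion.induction_on₂ with
    | hp => exact isClosed_eq (by fun_prop) (by fun_prop)
    | ih f g =>
      simp only [← coe_star, ← coe_mul]
      exact coe_eq_coe fun π => by simp only [map_star, map_mul, star_mul]
  star_add a b := by
    induction a, b using Completion.induction_on₂ with
    | hp => exact isClosed_eq (by fun_prop) (by fun_prop)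
    | ih f g =>
      simp only [← coe_star, ← Completion.coe_add]
      exact coe_eq_coe fun π => by simp only [map_star, map_add, star_add]

theorem continuous_smul' (c : ℂ) : Continuous fun a : CrossedProduct α μ => c • a :=
  continuous_const_smul c

theorem smul_mul (c : ℂ) (a b : CrossedProduct α μ) : c • a * b = c • (a * b) := by
  induction a, b using Completion.induction_on₂ with
  | hp =>
    exact isClosed_eq
      (((continuous_smul' (α := α) (μ := μ) c).comp continuous_fst).mul continuous_snd)
      ((continuous_smul' (α := α) (μ := μ) c).comp (continuous_fst.mul continuous_snd))
  | ih f g =>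
    simp only [← coe_mul, ← Completion.coe_smul]
    exact coe_eq_coe fun π => by simp only [map_mul, map_smul, smul_mul_assoc]

theorem mul_smul (c : ℂ) (a b : CrossedProduct α μ) : a * c • b = c • (a * b) := by
  induction a, b using Completion.induction_on₂ with
  | hp =>
    exact isClosed_eq
      (continuous_fst.mul ((continuous_smul' (α := α) (μ := μ) c).comp continuous_snd))
      ((continuous_smul' (α := α) (μ := μ) c).comp (continuous_fst.mul continuous_snd))
  | ih f g =>
    simp only [← coe_mul, ← Completion.coe_smul]
    exact coe_eq_coe fun π => by simp only [map_mul, map_smul, mul_smul_comm]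

instance : StarModule ℂ (CrossedProduct α μ) where
  star_smul c a := by
    induction a using Completion.induction_on with
    | hp =>
      exact isClosed_eq
        (continuous_star.comp (continuous_smul' (α := α) (μ := μ) c))
        ((continuous_smul' (α := α) (μ := μ) (star c)).comp continuous_star)
    | ih f =>
      simp only [← coe_star, ← Completion.coe_smul]
      exact coe_eq_coe fun π => by simp only [map_star, map_smul, star_smul]

instance : NonUnitalCStarAlgebra (CrossedProduct α μ) where
  norm_mul_self_le a := by
    induction a using Completion.induction_on with
    | hp => exact isClosed_le (by fun_prop) (by fun_prop)
    | ih f =>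
      simp only [← coe_star, ← coe_mul, Completion.norm_coe]
      exact norm_mul_self_le f
  smul_assoc c a b := smul_mul c a b
  smul_comm c a b := (mul_smul c a b).symm

end CrossedProduct

end Envelope

/-! ### `C₀(X)`-valued functions and the translation action -/

section Translation

variable {G : Type u} {X : Type v} [TopologicalSpace G] [TopologicalSpace X]

/-- A jointly continuous family of functions in `C₀(X)` that is locally uniformly small outside a
compact set is norm continuous. -/
theorem continuous_family_zeroAtInfty [LocallyCompactSpace X] {F : G → C₀(X, ℂ)}
    (hF : Continuous fun p : G × X => F p.1 p.2)
    (h : ∀ s₀ : G, ∀ ε : ℝ, 0 < ε → ∃ L : Set X, IsCompact L ∧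
      ∀ᶠ s in 𝓝 s₀, ∀ x ∉ L, ‖F s x‖ ≤ ε) : Continuous F := by
  rw [continuous_iff_continuousAt]
  intro s₀
  rw [ContinuousAt, Metric.tendsto_nhds]
  intro ε hε
  have hε3 : (0 : ℝ) < ε / 3 := by positivity
  obtain ⟨L, hL, hN⟩ := h s₀ (ε / 3) hε3
  let Φ : C(G, C(X, ℂ)) := ContinuousMap.curry ⟨fun p : G × X => F p.1 p.2, hF⟩
  have hΦ := (ContinuousMap.tendsto_iff_forall_isCompact_tendstoUniformlyOn.1
    (Φ.continuous.tendsto s₀)) L hL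
  have hΦ' := Metric.tendstoUniformlyOn_iff.1 hΦ (ε / 3) hε3
  have h0 : ∀ x ∉ L, ‖F s₀ x‖ ≤ ε / 3 := hN.self_of_nhds
  filter_upwards [hN, hΦ'] with s hs hs'
  have hle : ‖F s - F s₀‖ ≤ 2 * (ε / 3) := by
    rw [← ZeroAtInftyContinuousMap.norm_toBCF_eq_norm]
    refine (BoundedContinuousFunction.norm_le (by positivity)).2 fun x => ?_
    change ‖(F s - F s₀) x‖ ≤ 2 * (ε / 3)
    by_cases hx : x ∈ L
    · have h1 : dist (F s₀ x) (F s x) < ε / 3 := hs' x hx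
      rw [dist_comm, dist_eq_norm] at h1
      have h2 : ‖(F s - F s₀) x‖ < ε / 3 := h1
      linarith
    · have h1 : ‖(F s - F s₀) x‖ ≤ ‖F s x‖ + ‖F s₀ x‖ := norm_sub_le (F s x) (F s₀ x)
      linarith [hs x hx, h0 x hx]
  rw [dist_eq_norm]
  linarith

section Slice

variable [R1Space X]

/-- The slice `x ↦ F (x, s)` of `F ∈ C_c(X × G)`. -/
def ccSlice (F : C_c(X × G, ℂ)) (s : G) : C₀(X, ℂ) where
  toFun x := F (x, s)
  continuous_toFun := F.continuous_toFun.comp (by fun_prop)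
  zero_at_infty' := by
    refine HasCompactSupport.is_zero_at_infty ?_
    refine HasCompactSupport.of_support_subset_isCompact
      (F.hasCompactSupport.isCompact.image continuous_fst) ?_
    intro x hx
    exact ⟨(x, s), subset_tsupport _ hx, rfl⟩

@[simp] theorem ccSlice_apply (F : C_c(X × G, ℂ)) (s : G) (x : X) : ccSlice F s x = F (x, s) := rfl

theorem continuous_ccSlice [LocallyCompactSpace X] (F : C_c(X × G, ℂ)) : Continuous (ccSlice F) := by
  refine continuous_family_zeroAtInfty ?_ ?_
  · exact F.continuous_toFun.comp (continuous_snd.prodMk continuous_fst)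
  · intro s₀ ε hε
    refine ⟨_, F.hasCompactSupport.isCompact.image continuous_fst, Eventually.of_forall ?_⟩
    intro s x hx
    have : F (x, s) = 0 := image_eq_zero_of_notMem_tsupport fun h => hx ⟨_, h, rfl⟩
    rw [ccSlice_apply, this, norm_zero]
    exact hε.le

theorem hasCompactSupport_ccSlice [R1Space G] (F : C_c(X × G, ℂ)) : HasCompactSupport (ccSlice F) := by
  refine HasCompactSupport.of_support_subset_isCompact
    (F.hasCompactSupport.isCompact.image continuous_snd) ?_
  intro s hs
  by_contra h
  refine hs ?_
  ext x
  have : F (x, s) = 0 := image_eq_zero_of_notMem_tsupport fun h' => h ⟨(x, s), h', rfl⟩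
  exact this

end Slice

variable [Group G] [MulAction G X] [ContinuousSMul G X]

/-- The left leftTranslate `x ↦ f (s⁻¹ • x)` of `f ∈ C₀(X)`. -/
def leftTranslate (s : G) (f : C₀(X, ℂ)) : C₀(X, ℂ) where
  toFun x := f (s⁻¹ • x)
  continuous_toFun := f.continuous_toFun.comp (continuous_const_smul s⁻¹)
  zero_at_infty' := f.zero_at_infty'.comp (Homeomorph.smul s⁻¹).isClosedEmbedding.tendsto_cocompact

@[simp] theorem leftTranslate_apply (s : G) (f : C₀(X, ℂ)) (x : X) :
    leftTranslate s f x = f (s⁻¹ • x) := rfl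

variable [IsTopologicalGroup G]

open scoped Pointwise in
theorem continuous_leftTranslate [LocallyCompactSpace G] [LocallyCompactSpace X] (f : C₀(X, ℂ)) :
    Continuous fun s : G => leftTranslate s f := by
  refine continuous_family_zeroAtInfty ?_ ?_
  · exact (map_continuous f).comp (by fun_prop : Continuous fun p : G × X => p.1⁻¹ • p.2)
  · intro s₀ ε hε
    obtain ⟨N, hN, hNs⟩ := exists_compact_mem_nhds s₀
    have hf : ∀ᶠ x in cocompact X, ‖f x‖ < ε := by
      have := f.zero_at_infty'.norm
      rw [norm_zero] at this
      exact this.eventually_lt_const hε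
    obtain ⟨K, hK, hKf⟩ := mem_cocompact.1 hf
    refine ⟨N • K, hN.smul_set hK, ?_⟩
    filter_upwards [hNs] with s hs x hx
    refine le_of_lt (hKf fun hxK => hx ⟨s, hs, s⁻¹ • x, hxK, smul_inv_smul s x⟩)

variable (G X) in
/-- The action of `G` on `C₀(X)` induced by a continuous left action of `G` on `X`:
`α_s f x = f (s⁻¹ • x)`. -/
def translationAction [LocallyCompactSpace G] [LocallyCompactSpace X] : CStarAction G C₀(X, ℂ) where
  aut s :=
    { toFun := leftTranslate s
      invFun := leftTranslate s⁻¹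
      left_inv := fun f => by ext x; simp
      right_inv := fun f => by ext x; simp
      map_mul' := fun f g => rfl
      map_add' := fun f g => rfl
      map_star' := fun f => rfl
      map_smul' := fun c f => rfl }
  aut_mul s t f := by
    ext x
    show f ((s * t)⁻¹ • x) = f (t⁻¹ • s⁻¹ • x)
    rw [mul_inv_rev, mul_smul]
  continuous_aut f := continuous_leftTranslate f

theorem translationAction_apply [LocallyCompactSpace G] [LocallyCompactSpace X] (s : G)
    (f : C₀(X, ℂ)) (x : X) : (translationAction G X).aut s f x = f (s⁻¹ • x) := rfl

/-! ### The embedding of `C_c(X × G)` -/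

/-- The embedding `F ↦ F̃`, `F̃ s x = F (x, s)`, of `C_c(X × G)` into `C_c(G, C₀(X))`. -/
def ConvAlg.ofProd [R1Space X] [LocallyCompactSpace G] [LocallyCompactSpace X] [MeasurableSpace G]
    (μ : Measure G) (F : C_c(X × G, ℂ)) : ConvAlg (translationAction G X) μ :=
  ConvAlg.mk (ccSlice F) (continuous_ccSlice F) (hasCompactSupport_ccSlice F)

end Translation

/-! ### Rank one functions and compact operators -/

section RankOne

variable {G : Type u} [Group G] [TopologicalSpace G] [IsTopologicalGroup G]

/-- The function `θ̃_{f,g} (x, s) = f x * conj (g (s⁻¹ x))` in `C_c(G × G)`. -/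
def thetaFun (f g : C_c(G, ℂ)) : C_c(G × G, ℂ) where
  toFun p := f p.1 * conj (g (p.2⁻¹ * p.1))
  continuous_toFun := by
    have hf := map_continuous f
    have hg := map_continuous g
    fun_prop
  hasCompactSupport' := by
    refine HasCompactSupport.of_support_subset_isCompact
      (K := (fun q : G × G => (q.1, q.1 * q.2⁻¹)) '' (tsupport f ×ˢ tsupport g))
      ((f.hasCompactSupport.isCompact.prod g.hasCompactSupport.isCompact).image (by fun_prop)) ?_
    rintro ⟨x, s⟩ hxs
    refine ⟨(x, s⁻¹ * x), ⟨?_, ?_⟩, by simp⟩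
    · by_contra h
      exact hxs (by simp [image_eq_zero_of_notMem_tsupport h])
    · by_contra h
      exact hxs (by simp [image_eq_zero_of_notMem_tsupport h])

variable [LocallyCompactSpace G] [MeasurableSpace G] [BorelSpace G]
  (μ : Measure G) [IsFiniteMeasureOnCompacts μ]

/-- The element `θ̃_{f,g}` of the crossed product `C₀(G) ⋊ G`. -/
def thetaElt (f g : C_c(G, ℂ)) : CrossedProduct (translationAction G G) μ :=
  ((ConvAlg.ofProd μ (thetaFun f g) : ConvAlg (translationAction G G) μ) :
    CrossedProduct (translationAction G G) μ)

/-- The class in `L²(G, μ)` of a compactly supported continuous function. -/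
def toL2 (f : C_c(G, ℂ)) : Lp ℂ 2 μ :=
  ((map_continuous f).memLp_of_hasCompactSupport f.hasCompactSupport).toLp f

end RankOne

section Compact

variable (H : Type*) [NormedAddCommGroup H] [InnerProductSpace ℂ H] [CompleteSpace H]

variable {H} in
/-- The adjoint of a compact operator on a Hilbert space is compact. -/
theorem isCompactOperator_star {T : H →L[ℂ] H} (hT : IsCompactOperator T) :
    IsCompactOperator (star T : H →L[ℂ] H) := by
  let S : H →L[ℂ] H := T * star T
  have hS : IsCompactOperator S := hT.comp_clm (star T)
  have key : ∀ x ∈ Metric.closedBall (0 : H) 1, ∀ y ∈ Metric.closedBall (0 : H) 1,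
      ‖star T x - star T y‖ ^ 2 ≤ 2 * ‖S x - S y‖ := by
    intro x hx y hy
    rw [mem_closedBall_zero_iff] at hx hy
    have h1 : ((‖star T (x - y)‖ ^ 2 : ℝ) : ℂ) = inner ℂ (S (x - y)) (x - y) := by
      have : inner ℂ (T (star T (x - y))) (x - y) = inner ℂ (star T (x - y)) (star T (x - y)) := by
        rw [ContinuousLinearMap.star_eq_adjoint, ContinuousLinearMap.adjoint_inner_right]
      rw [show S (x - y) = T (star T (x - y)) from rfl, this, inner_self_eq_norm_sq_to_K]
      norm_cast
    have h2 : ‖star T (x - y)‖ ^ 2 ≤ ‖S (x - y)‖ * ‖x - y‖ := by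
      have := norm_inner_le_norm (𝕜 := ℂ) (S (x - y)) (x - y)
      rw [← h1, Complex.norm_real, Real.norm_of_nonneg (by positivity)] at this
      exact this
    rw [map_sub, map_sub] at h2
    have h3 : ‖x - y‖ ≤ 2 := (norm_sub_le x y).trans (by linarith)
    nlinarith [norm_nonneg (S x - S y)]
  have hSK := (isCompactOperator_iff_isCompact_closure_image_closedBall
    (S : H →ₗ[ℂ] H) zero_lt_one).1 hS
  refine (isCompactOperator_iff_isCompact_closure_image_closedBall
    ((star T : H →L[ℂ] H) : H →ₗ[ℂ] H) zero_lt_one).2 ?_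
  refine isCompact_iff_totallyBounded_isComplete.2
    ⟨TotallyBounded.closure ?_, isClosed_closure.isComplete⟩
  rw [Metric.totallyBounded_iff]
  intro ε hε
  obtain ⟨t, hts, htf, htc⟩ := Metric.finite_approx_of_totallyBounded
    (hSK.totallyBounded.subset subset_closure) (ε ^ 2 / 2) (by positivity)
  have hts' : ∀ y ∈ t, ∃ x ∈ Metric.closedBall (0 : H) 1, S x = y := fun y hy => hts hy
  choose! p hp hpS using hts'
  refine ⟨(fun y => star T (p y)) '' t, htf.image _, ?_⟩
  rintro _ ⟨x, hx, rfl⟩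
  obtain ⟨y, hy, hxy⟩ := Set.mem_iUnion₂.1 (htc ⟨x, hx, rfl⟩)
  refine Set.mem_iUnion₂.2 ⟨star T (p y), ⟨y, hy, rfl⟩, ?_⟩
  rw [Metric.mem_ball, dist_eq_norm] at hxy ⊢
  have h1 := key x hx (p y) (hp y hy)
  have h2 : S (p y) = y := hpS y hy
  rw [h2] at h1
  have h3 : ‖S x - y‖ < ε ^ 2 / 2 := hxy
  exact lt_of_pow_lt_pow_left₀ 2 hε.le (show ‖star T x - star T (p y)‖ ^ 2 < ε ^ 2 by linarith)

/-- The C⋆-algebra `𝒦(H)` of compact operators on the Hilbert space `H`. -/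
def compactOperators : NonUnitalStarSubalgebra ℂ (H →L[ℂ] H) where
  carrier := {T | IsCompactOperator T}
  add_mem' hS hT := hS.add hT
  zero_mem' := isCompactOperator_zero
  mul_mem' {_ T} hS _ := hS.comp_clm T
  smul_mem' c _ hT := hT.smul c
  star_mem' hT := isCompactOperator_star hT

instance : IsClosed (compactOperators H : Set (H →L[ℂ] H)) :=
  isClosed_setOfPred_isCompactOperator

end Compact

end

/-! Substitute y = s⁻¹x. An element F of C_c(G, C₀(G)) becomes the kernel (x, y) ↦ F(xy⁻¹)(x), and
θ̃_{f,g} becomes f(x) conj(g(y)), the kernel of a rank-one operator. Unimodularity makes μ invariant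
under right translation and inversion, so t ↦ t⁻¹x preserves integrals, and the θ̃ multiply like
matrix units (`thetaElt_mul_thetaElt`, `star_thetaElt`).

Multiplication operators and translations on L²(G) form a covariant pair. Its integrated form is
bounded by ‖·‖₁, hence extends to a representation π of the crossed product, and π(θ̃_{f,g}) is the
rank-one operator θ_{f,g} (`integratedForm_thetaFun`).

For density (`dense_thetaSpan`), the universal norm is at most the L¹ norm, so it suffices to
approximate F uniformly with the s-supports in one compact set. After a cutoff in x, a partition of
unity replaces the kernel by a finite sum of terms φ(x)h(y), that is, by a combination of elements
θ̃.

The decisive point is that π is injective on the full crossed product. By density, θ̃_{f₁,g₁} a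
θ̃_{f₂,g₂} = ⟨π(a)f₂|g₁⟩ θ̃_{f₁,g₂} for every a (`thetaElt_mul_mul_thetaElt`). If π(a) = 0, then a
is annihilated from both sides by a total set, and the C⋆-identity gives a = 0. An injective
⋆-homomorphism of C⋆-algebras is isometric, so π has closed range. The range consists of compact
operators and contains all rank-one operators, so it is 𝒦(L²(G)). -/

noncomputable section

/-! ### Haar measure on unimodular groups -/

section Unimodular

variable {G : Type*} [Group G] [TopologicalSpace G] [IsTopologicalGroup G] [LocallyCompactSpace G]
  [MeasurableSpace G] [BorelSpace G] (μ : Measure G) [μ.IsHaarMeasure] [μ.InnerRegular]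

theorem IsUnimodular.isMulRightInvariant (hG : IsUnimodular G) : μ.IsMulRightInvariant where
  map_mul_right_eq_self g := by
    have h : Measure.modularCharacterFun g = 1 := by
      have := hG g⁻¹
      rw [modularFunction, inv_inv] at this
      exact_mod_cast this
    rw [Measure.map_right_mul_eq_modularCharacterFun_smul, h, one_smul]

/-- A bi-invariant inner regular Haar measure is invariant under inversion. -/
theorem isInvInvariant_of_isMulRightInvariant [μ.IsMulRightInvariant] : μ.IsInvInvariant := by
  constructor
  let c : ℝ≥0∞ := Measure.haarScalarFactor μ.inv μ
  -- Right invariance of μ is left invariance of `μ.inv`, so uniqueness of Haar measure applies.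
  -- Inverting twice then forces c² = 1.
  have hc : μ.inv = c • μ := Measure.isMulLeftInvariant_eq_smul_of_innerRegular μ.inv μ
  have : Measure.map Inv.inv (Measure.map Inv.inv μ) = c ^ 2 • μ := by
    rw [← Measure.inv_def μ, hc, Measure.map_smul, ← Measure.inv_def μ, hc, smul_smul, pow_two]
  have μeq : μ = c ^ 2 • μ := by
    rw [Measure.map_map continuous_inv.measurable continuous_inv.measurable] at this
    simpa only [inv_involutive, Function.Involutive.comp_self, Measure.map_id]
  -- A compact set with nonempty interior has measure in (0, ∞), so it can be cancelled.
  have K : TopologicalSpace.PositiveCompacts G := Classical.arbitrary _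
  have : c ^ 2 * μ K = 1 ^ 2 * μ K := by
    conv_rhs => rw [μeq]
    simp
  have : c ^ 2 = 1 ^ 2 :=
    (ENNReal.mul_left_inj (Measure.measure_pos_of_nonempty_interior _ K.interior_nonempty).ne'
          K.isCompact.measure_lt_top.ne).1 this
  have : c = 1 := (ENNReal.pow_right_strictMono two_ne_zero).injective this
  rw [hc, this, one_smul]

end Unimodular

/-! ### Integrated forms of covariant representations -/

section Covariant

variable {G : Type u} {A : Type v} [Group G] [TopologicalSpace G] [NonUnitalCStarAlgebra A]

/-- A covariant representation of the dynamical system `(A, G, α)` on the Hilbert space `H`: a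
⋆-representation of `A` and a strongly continuous unitary representation of `G`, intertwined
by `α`. -/
structure CovariantRep (α : CStarAction G A) (H : Type*) [NormedAddCommGroup H]
    [InnerProductSpace ℂ H] [CompleteSpace H] where
  /-- the representation of the algebra -/
  rep : A →⋆ₙₐ[ℂ] (H →L[ℂ] H)
  /-- the representation of the group -/
  unitary : G → H →L[ℂ] H
  unitary_one : unitary 1 = 1
  unitary_mul : ∀ s t, unitary (s * t) = unitary s * unitary t
  inner_unitary : ∀ s ξ η, inner ℂ (unitary s ξ) η = inner ℂ ξ (unitary s⁻¹ η)
  continuous_unitary : Continuous fun p : G × H => unitary p.1 p.2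
  covariant : ∀ s a, unitary s * rep a = rep (α.aut s a) * unitary s

namespace CovariantRep

variable {α : CStarAction G A} {H : Type*} [NormedAddCommGroup H] [InnerProductSpace ℂ H]
  [CompleteSpace H] (R : CovariantRep α H)

theorem norm_unitary_apply (s : G) (ξ : H) : ‖R.unitary s ξ‖ = ‖ξ‖ := by
  have h : inner ℂ (R.unitary s ξ) (R.unitary s ξ) = inner ℂ ξ ξ := by
    rw [R.inner_unitary, ← mul_apply_eq_comp, ← R.unitary_mul, inv_mul_cancel,
      R.unitary_one, one_apply_eq_self]
  rw [inner_self_eq_norm_sq_to_K, inner_self_eq_norm_sq_to_K] at h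
  have h' : ‖R.unitary s ξ‖ ^ 2 = ‖ξ‖ ^ 2 := by exact_mod_cast h
  exact (pow_left_inj₀ (norm_nonneg _) (norm_nonneg _) two_ne_zero).1 h'

theorem norm_rep_le (a : A) : ‖R.rep a‖ ≤ ‖a‖ := NonUnitalStarAlgHom.norm_apply_le R.rep a

theorem continuous_rep : Continuous R.rep :=
  AddMonoidHomClass.continuous_of_bound R.rep 1 fun a => by simpa using R.norm_rep_le a

variable [MeasurableSpace G] {μ : Measure G} 

theorem continuous_rep_unitary (F : ConvAlg α μ) :
    Continuous fun p : G × H => R.rep (F p.1) (R.unitary p.1 p.2) :=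
  ((R.continuous_rep.comp F.continuous).comp continuous_fst).clm_apply R.continuous_unitary

theorem norm_rep_unitary_le (F : ConvAlg α μ) (s : G) (ξ : H) :
    ‖R.rep (F s) (R.unitary s ξ)‖ ≤ ‖F s‖ * ‖ξ‖ :=
  (ContinuousLinearMap.le_of_opNorm_le _ (R.norm_rep_le _) _).trans_eq
    (by rw [R.norm_unitary_apply])

variable [BorelSpace G] [IsFiniteMeasureOnCompacts μ]

theorem integrable_rep_unitary (F : ConvAlg α μ) (ξ : H) :
    Integrable (fun s => R.rep (F s) (R.unitary s ξ)) μ := by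
  refine ((R.continuous_rep_unitary F).comp
    (by fun_prop : Continuous fun s : G => (s, ξ))).integrable_of_hasCompactSupport ?_
  refine F.hasCompactSupport.mono fun s hs => ?_
  contrapose! hs
  simp only [Function.mem_support, ne_eq, not_not] at hs ⊢
  simp [hs]

/-- The operator `∫ rep (F s) (unitary s) ds`. -/
def integratedForm (F : ConvAlg α μ) : H →L[ℂ] H :=
  LinearMap.mkContinuous
    { toFun := fun ξ => ∫ s, R.rep (F s) (R.unitary s ξ) ∂μ
      map_add' := fun ξ η => by
        simp only [map_add]
        exact integral_add (R.integrable_rep_unitary F ξ) (R.integrable_rep_unitary F η)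
      map_smul' := fun c ξ => by
        simp only [map_smul, RingHom.id_apply]
        exact integral_smul _ _ }
    F.norm₁ fun ξ => by
      rw [ConvAlg.norm₁, ← integral_mul_const]
      refine norm_integral_le_of_norm_le ?_ (ae_of_all _ fun s => R.norm_rep_unitary_le F s ξ)
      exact (F.continuous.norm.integrable_of_hasCompactSupport
        F.hasCompactSupport.norm).mul_const _

theorem integratedForm_apply (F : ConvAlg α μ) (ξ : H) :
    R.integratedForm F ξ = ∫ s, R.rep (F s) (R.unitary s ξ) ∂μ := rfl

theorem inner_integratedForm (F : ConvAlg α μ) (ξ η : H) :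
    inner ℂ ξ (R.integratedForm F η) = ∫ s, inner ℂ ξ (R.rep (F s) (R.unitary s η)) ∂μ :=
  (integral_inner (R.integrable_rep_unitary F η) ξ).symm

theorem norm_integratedForm_le (F : ConvAlg α μ) : ‖R.integratedForm F‖ ≤ F.norm₁ :=
  LinearMap.mkContinuous_norm_le _ (integral_nonneg fun _ => norm_nonneg _) _

variable [IsTopologicalGroup G]

open scoped Pointwise in
-- Covariance splits the integrand of the convolution into rep(F t) U_t applied to rep(K(t⁻¹s))
-- U_{t⁻¹s} ξ. Fubini and the left translation s ↦ ts then separate the two integrals.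
theorem integratedForm_mul [μ.IsMulLeftInvariant] (F K : ConvAlg α μ) :
    R.integratedForm (F * K) = R.integratedForm F * R.integratedForm K := by
  ext ξ
  have e (s t : G) : R.rep (F t * α.aut t (K (t⁻¹ * s))) (R.unitary s ξ)
      = R.rep (F t) (R.unitary t (R.rep (K (t⁻¹ * s)) (R.unitary (t⁻¹ * s) ξ))) := by
    have h := R.covariant t (K (t⁻¹ * s))
    have h' := DFunLike.congr_fun h (R.unitary (t⁻¹ * s) ξ)
    simp only [mul_apply_eq_comp] at h'
    rw [h', map_mul, mul_apply_eq_comp, ← mul_apply_eq_comp (R.unitary t),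
      ← R.unitary_mul, mul_inv_cancel_left]
  have h1 (s : G) : R.rep ((F * K) s) (R.unitary s ξ)
      = ∫ t, R.rep (F t) (R.unitary t (R.rep (K (t⁻¹ * s)) (R.unitary (t⁻¹ * s) ξ))) ∂μ := by
    -- a ↦ rep(a) U_s ξ is bounded and linear, so it passes through the `A`-valued integral that
    -- defines (F * K)(s).
    let ev : A →L[ℂ] H := (ContinuousLinearMap.apply ℂ H (R.unitary s ξ)).comp
      ⟨(R.rep : A →ₗ[ℂ] (H →L[ℂ] H)), R.continuous_rep⟩
    have h := ev.integral_comp_comm (ConvAlg.integrable_integrand F K s)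
    rw [ConvAlg.mul_apply]
    refine (h.symm.trans ?_)
    exact integral_congr_ae (ae_of_all _ fun t => e s t)
  have hc : Continuous fun p : G × G =>
      R.rep (F p.2) (R.unitary p.2 (R.rep (K (p.2⁻¹ * p.1)) (R.unitary (p.2⁻¹ * p.1) ξ))) := by
    have h2 : Continuous fun p : G × G => R.rep (K (p.2⁻¹ * p.1)) (R.unitary (p.2⁻¹ * p.1) ξ) :=
      (R.continuous_rep_unitary K).comp (by fun_prop : Continuous fun p : G × G => (p.2⁻¹ * p.1, ξ))
    exact (R.continuous_rep_unitary F).comp (continuous_snd.prodMk h2)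
  rw [mul_apply_eq_comp, integratedForm_apply, integratedForm_apply, integratedForm_apply]
  simp_rw [h1]
  rw [integral_integral_swap_of_hasCompactSupport hc]
  · refine integral_congr_ae (ae_of_all _ fun t => ?_)
    have := ((R.rep (F t)).comp (R.unitary t)).integral_comp_comm (R.integrable_rep_unitary K ξ)
    refine Eq.trans ?_ this
    exact integral_mul_left_eq_self
      (fun s => R.rep (F t) (R.unitary t (R.rep (K s) (R.unitary s ξ)))) t⁻¹
  -- A nonzero integrand needs t ∈ supp F and t⁻¹s ∈ supp K, hence s ∈ supp F · supp K.
  · refine HasCompactSupport.of_support_subset_isCompact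
      (K := (tsupport F * tsupport K) ×ˢ tsupport F)
      ((IsCompact.mul F.hasCompactSupport K.hasCompactSupport).prod F.hasCompactSupport) ?_
    rintro ⟨s, t⟩ hst
    have hF : F t ≠ 0 := fun h => hst (by simp [Function.uncurry, h])
    have hK : K (t⁻¹ * s) ≠ 0 := fun h => hst (by simp [Function.uncurry, h])
    exact ⟨⟨t, subset_tsupport _ hF, _, subset_tsupport _ hK, by simp⟩, subset_tsupport _ hF⟩

/-- Replacing s by s⁻¹ in the integral for `star F` leaves α_{s⁻¹}(F(s)⋆) and U_{s⁻¹}. Covariance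
turns their product into U_{s⁻¹} rep(F s)⋆, the adjoint of rep(F s) U_s. -/
theorem integratedForm_star [LocallyCompactSpace G] [μ.IsInvInvariant] (hG : IsUnimodular G)
    (F : ConvAlg α μ) :
    R.integratedForm (star F) = star (R.integratedForm F) := by
  rw [ContinuousLinearMap.star_eq_adjoint, ContinuousLinearMap.eq_adjoint_iff]
  intro ξ η
  rw [integratedForm_apply, integratedForm_apply, ← integral_inner (R.integrable_rep_unitary F η),
    ← inner_conj_symm, ← integral_inner (R.integrable_rep_unitary (star F) ξ), ← integral_conj,
    ← integral_inv_eq_self]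
  refine integral_congr_ae (ae_of_all _ fun s => ?_)
  have h := DFunLike.congr_fun (R.covariant s⁻¹ (star (F s))) ξ
  simp only [mul_apply_eq_comp] at h
  simp only [inner_conj_symm]
  rw [ConvAlg.star_apply, hG, Complex.ofReal_one, one_smul, inv_inv, ← h, R.inner_unitary, inv_inv,
    map_star, ContinuousLinearMap.star_eq_adjoint, ContinuousLinearMap.adjoint_inner_left]

end CovariantRep

end Covariant

section IntegratedForm

variable {G : Type u} {A : Type v} [Group G] [TopologicalSpace G] [IsTopologicalGroup G]
  [LocallyCompactSpace G] [NonUnitalCStarAlgebra A] [MeasurableSpace G] [BorelSpace G]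
  {α : CStarAction G A} {H : Type max u v} [NormedAddCommGroup H] [InnerProductSpace ℂ H]
  [CompleteSpace H]

/-- The integrated form of a covariant representation of a unimodular group. -/
def CovariantRep.boundedRep (R : CovariantRep α H) (hG : IsUnimodular G) (μ : Measure G)
    [IsFiniteMeasureOnCompacts μ] [μ.IsMulLeftInvariant] [μ.IsInvInvariant] :
    BoundedRep α μ where
  H := H
  hom :=
    { toFun := R.integratedForm
      map_smul' := fun c F => by
        ext ξ
        simp only [integratedForm_apply, ConvAlg.smul_apply, map_smul, _root_.smul_apply,
          MonoidHom.id_apply]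
        exact integral_smul _ _
      map_zero' := by ext ξ; simp [integratedForm_apply]
      map_add' := fun F K => by
        ext ξ
        simp only [integratedForm_apply, ConvAlg.add_apply, map_add, _root_.add_apply]
        exact integral_add (R.integrable_rep_unitary F ξ) (R.integrable_rep_unitary K ξ)
      map_mul' := R.integratedForm_mul
      map_star' := R.integratedForm_star hG }
  norm_hom_le := R.norm_integratedForm_le

end IntegratedForm


/-! ### The representation of `C₀(X)` by multiplication operators and the translation action -/

section Multiplication

variable {X : Type*} [TopologicalSpace X] [MeasurableSpace X] [OpensMeasurableSpace X]
  (ν : Measure X)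

theorem memLp_zeroAtInfty_mul (a : C₀(X, ℂ)) {ξ : X → ℂ} (hξ : MemLp ξ 2 ν) :
    MemLp (fun x => a x * ξ x) 2 ν :=
  hξ.of_le_mul (c := ‖a‖) ((map_continuous a).aestronglyMeasurable.mul hξ.1)
    (ae_of_all _ fun x => (norm_mul_le _ _).trans
      (mul_le_mul_of_nonneg_right (a.toBCF.norm_coe_le_norm x) (norm_nonneg _)))

/-- Multiplication by `a ∈ C₀(X)` on `L²(X, ν)`. -/
def mulOperator (a : C₀(X, ℂ)) : Lp ℂ 2 ν →L[ℂ] Lp ℂ 2 ν :=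
  LinearMap.mkContinuous
    { toFun := fun ξ => (memLp_zeroAtInfty_mul ν a (Lp.memLp ξ)).toLp _
      map_add' := fun ξ η => by
        rw [← MemLp.toLp_add]
        refine MemLp.toLp_congr _ _ ?_
        filter_upwards [Lp.coeFn_add ξ η] with x hx
        rw [Pi.add_apply, ← mul_add, ← Pi.add_apply, ← hx]
      map_smul' := fun c ξ => by
        rw [RingHom.id_apply, ← MemLp.toLp_const_smul]
        refine MemLp.toLp_congr _ _ ?_
        filter_upwards [Lp.coeFn_smul c ξ] with x hx
        simp only [hx, Pi.smul_apply, smul_eq_mul]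
        ring }
    ‖a‖ fun ξ => by
      refine Lp.norm_le_mul_norm_of_ae_le_mul ?_
      filter_upwards [(memLp_zeroAtInfty_mul ν a (Lp.memLp ξ)).coeFn_toLp] with x hx
      refine (congrArg norm hx).trans_le ((norm_mul_le _ _).trans
        (mul_le_mul_of_nonneg_right (a.toBCF.norm_coe_le_norm x) (norm_nonneg _)))

theorem coeFn_mulOperator (a : C₀(X, ℂ)) (ξ : Lp ℂ 2 ν) :
    mulOperator ν a ξ =ᵐ[ν] fun x => a x * ξ x :=
  (memLp_zeroAtInfty_mul ν a (Lp.memLp ξ)).coeFn_toLp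

/-- The representation of `C₀(X)` on `L²(X, ν)` by multiplication operators. -/
def mulRep : C₀(X, ℂ) →⋆ₙₐ[ℂ] (Lp ℂ 2 ν →L[ℂ] Lp ℂ 2 ν) where
  toFun := mulOperator ν
  map_smul' c a := by
    ext1 ξ
    refine Lp.ext ?_
    filter_upwards [coeFn_mulOperator ν (c • a) ξ, coeFn_mulOperator ν a ξ,
      Lp.coeFn_smul c (mulOperator ν a ξ)] with x h1 h2 h3
    simp only [MonoidHom.id_apply, _root_.smul_apply, h1, h3, Pi.smul_apply, h2,
      ZeroAtInftyContinuousMap.smul_apply, smul_eq_mul, mul_assoc]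
  map_zero' := by
    ext1 ξ
    refine Lp.ext ?_
    filter_upwards [coeFn_mulOperator ν 0 ξ, Lp.coeFn_zero ℂ 2 ν] with x h1 h2
    exact h1.trans ((zero_mul _).trans h2.symm)
  map_add' a b := by
    ext1 ξ
    refine Lp.ext ?_
    filter_upwards [coeFn_mulOperator ν (a + b) ξ, coeFn_mulOperator ν a ξ,
      coeFn_mulOperator ν b ξ, Lp.coeFn_add (mulOperator ν a ξ) (mulOperator ν b ξ)]
      with x h1 h2 h3 h4
    refine h1.trans (Eq.trans ?_ h4.symm)
    rw [Pi.add_apply, h2, h3, ZeroAtInftyContinuousMap.add_apply, add_mul]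
  map_mul' a b := by
    ext1 ξ
    refine Lp.ext ?_
    filter_upwards [coeFn_mulOperator ν (a * b) ξ, coeFn_mulOperator ν b ξ,
      coeFn_mulOperator ν a (mulOperator ν b ξ)] with x h1 h2 h3
    rw [h1, mul_apply_eq_comp, h3, h2, ZeroAtInftyContinuousMap.mul_apply, mul_assoc]
  map_star' a := by
    rw [ContinuousLinearMap.star_eq_adjoint, ContinuousLinearMap.eq_adjoint_iff]
    intro ξ η
    rw [L2.inner_def, L2.inner_def]
    refine integral_congr_ae ?_
    filter_upwards [coeFn_mulOperator ν (star a) ξ, coeFn_mulOperator ν a η] with x h1 h2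
    simp only [h1, h2, RCLike.inner_apply, ZeroAtInftyContinuousMap.star_apply, map_mul,
      RCLike.star_def, RCLike.conj_conj]
    ring

theorem coeFn_mulRep (a : C₀(X, ℂ)) (ξ : Lp ℂ 2 ν) : mulRep ν a ξ =ᵐ[ν] fun x => a x * ξ x :=
  coeFn_mulOperator ν a ξ

end Multiplication

section Translation

variable {G : Type u} {X : Type v} [Group G] [TopologicalSpace G] [TopologicalSpace X]
  [MulAction G X] [ContinuousSMul G X]
  [MeasurableSpace X] [BorelSpace X] (ν : Measure X) [SMulInvariantMeasure G X ν]

/-- The operator `ξ ↦ ξ (s⁻¹ • ·)` on `L²(X, ν)`. -/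
def translationIsometry (s : G) : Lp ℂ 2 ν →ₗᵢ[ℂ] Lp ℂ 2 ν where
  toLinearMap := DistribSMul.toLinearMap ℂ (Lp ℂ 2 ν) (DomMulAct.mk s⁻¹)
  norm_map' ξ := DomMulAct.norm_smul_Lp _ ξ

theorem translationIsometry_apply (s : G) (ξ : Lp ℂ 2 ν) :
    translationIsometry ν s ξ = DomMulAct.mk s⁻¹ • ξ := rfl

theorem coeFn_translationIsometry (s : G) (ξ : Lp ℂ 2 ν) :
    translationIsometry ν s ξ =ᵐ[ν] fun x => ξ (s⁻¹ • x) :=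
  DomMulAct.smul_Lp_ae_eq (DomMulAct.mk s⁻¹) ξ

theorem translationIsometry_one (ξ : Lp ℂ 2 ν) : translationIsometry ν (1 : G) ξ = ξ := by
  rw [translationIsometry_apply, inv_one, DomMulAct.mk_one, one_smul]

theorem translationIsometry_mul (s t : G) (ξ : Lp ℂ 2 ν) :
    translationIsometry ν (s * t) ξ = translationIsometry ν s (translationIsometry ν t ξ) := by
  simp only [translationIsometry_apply, mul_inv_rev, DomMulAct.mk_mul, mul_smul]

variable [IsTopologicalGroup G] [LocallyCompactSpace G] [LocallyCompactSpace X] [R1Space X]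
  [IsLocallyFiniteMeasure ν] [ν.InnerRegularCompactLTTop]

variable (G) in
/-- The covariant representation of `(C₀(X), G)` on `L²(X, ν)` by multiplication operators and
translations. -/
def translationRep : CovariantRep (translationAction G X) (Lp ℂ 2 ν) where
  rep := mulRep ν
  unitary s := (translationIsometry ν s).toContinuousLinearMap
  unitary_one := ContinuousLinearMap.ext fun ξ => translationIsometry_one ν ξ
  unitary_mul s t := ContinuousLinearMap.ext fun ξ => translationIsometry_mul ν s t ξ
  inner_unitary s ξ η := by
    -- Writing η as a translate by s reduces the adjoint relation to the isometry property.
    have h : translationIsometry ν s (translationIsometry ν s⁻¹ η) = η := by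
      rw [← translationIsometry_mul, mul_inv_cancel, translationIsometry_one]
    conv_lhs => rw [← h]
    exact (translationIsometry ν s).inner_map_map _ _
  continuous_unitary := by
    borelize G
    -- Joint continuity of translation on Lᵖ uses that p is finite.
    have : Fact ((2 : ℝ≥0∞) ≠ ∞) := ⟨by simp⟩
    have h : Continuous fun p : Gᵈᵐᵃ × Lp ℂ 2 ν => p.1 • p.2 := continuous_smul
    exact h.comp
      (by fun_prop : Continuous fun p : G × Lp ℂ 2 ν => (DomMulAct.mkHomeomorph p.1⁻¹, p.2))
  covariant s a := by
    ext1 ξ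
    refine Lp.ext ?_
    -- The almost-everywhere formula for aξ is needed at s⁻¹ • x; translation preserves null sets.
    have hq := (measurePreserving_smul s⁻¹ ν).quasiMeasurePreserving.ae_eq (coeFn_mulRep ν a ξ)
    filter_upwards [coeFn_translationIsometry ν s (mulRep ν a ξ), coeFn_translationIsometry ν s ξ,
      coeFn_mulRep ν ((translationAction G X).aut s a) (translationIsometry ν s ξ), hq]
      with x h1 h2 h3 h4
    simp only [mul_apply_eq_comp, LinearIsometry.coe_toContinuousLinearMap]
    rw [h1, h3, h2, translationAction_apply]
    exact h4

theorem coeFn_translationRep (s : G) (a : C₀(X, ℂ)) (ξ : Lp ℂ 2 ν) :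
    (translationRep G ν).rep a ((translationRep G ν).unitary s ξ) =ᵐ[ν]
      fun x => a x * ξ (s⁻¹ • x) := by
  filter_upwards [coeFn_mulRep ν a (translationIsometry ν s ξ), coeFn_translationIsometry ν s ξ]
    with x h1 h2
  rw [h2] at h1
  exact h1

end Translation

/-! ### Compactly supported functions in `L²` -/

section Inversion

variable {G : Type*} [Group G] [TopologicalSpace G] [IsTopologicalGroup G]
  [MeasurableSpace G] [BorelSpace G] {μ : Measure G}

/-- This is the form in which unimodularity enters the kernel computations: as s varies, y = s⁻¹x is
distributed by the same Haar measure, whatever x is. -/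
theorem integral_inv_mul_right_eq_self [μ.IsMulRightInvariant] [μ.IsInvInvariant] {E : Type*}
    [NormedAddCommGroup E] [NormedSpace ℝ E] (f : G → E) (x : G) :
    ∫ s, f (s⁻¹ * x) ∂μ = ∫ s, f s ∂μ := by
  rw [integral_inv_eq_self (fun s => f (s * x)) μ, integral_mul_right_eq_self]

end Inversion

section CompactSupport

variable {X : Type*} [TopologicalSpace X] [MeasurableSpace X] [BorelSpace X] (μ : Measure X)
  [IsFiniteMeasureOnCompacts μ]

theorem coeFn_toL2 (f : C_c(X, ℂ)) : toL2 μ f =ᵐ[μ] f := MemLp.coeFn_toLp _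

theorem inner_toL2 (f g : C_c(X, ℂ)) :
    inner ℂ (toL2 μ f) (toL2 μ g) = ∫ x, g x * conj (f x) ∂μ := by
  rw [L2.inner_def]
  refine integral_congr_ae ?_
  filter_upwards [coeFn_toL2 μ f, coeFn_toL2 μ g] with x h1 h2
  rw [h1, h2, RCLike.inner_apply]

theorem denseRange_toL2 [LocallyCompactSpace X] [SecondCountableTopology X] [T2Space X] :
    DenseRange (toL2 μ) := by
  intro ξ
  rw [Metric.mem_closure_iff]
  intro ε hε
  obtain ⟨g, hg, hle, hgc, hgm⟩ := (Lp.memLp ξ).exists_hasCompactSupport_eLpNorm_sub_le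
    (by simp) (ε := ENNReal.ofReal (ε / 2)) (by simpa using hε)
  refine ⟨_, ⟨⟨⟨g, hgc⟩, hg⟩, rfl⟩, ?_⟩
  have h : toL2 μ ⟨⟨g, hgc⟩, hg⟩ = hgm.toLp g := rfl
  rw [h, Lp.dist_def]
  refine lt_of_le_of_lt ?_ (half_lt_self hε)
  refine ENNReal.toReal_le_of_le_ofReal (by positivity) (le_trans (le_of_eq ?_) hle)
  refine eLpNorm_congr_ae ?_
  filter_upwards [hgm.coeFn_toLp] with x hx
  simp [hx]

end CompactSupport

/-! ### Rank-one kernels give rank-one operators on L²(G) -/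

section RegularRep

variable {G : Type u} [Group G] [TopologicalSpace G] [IsTopologicalGroup G] [LocallyCompactSpace G]
  [MeasurableSpace G] [BorelSpace G] (μ : Measure G) [IsFiniteMeasureOnCompacts μ]
  [SecondCountableTopology G] [T2Space G]
  [μ.IsMulLeftInvariant] [μ.IsMulRightInvariant] [μ.IsInvInvariant]

open scoped Pointwise in
-- Formally the value at x of the left side on h is f(x) ∫ h(s⁻¹x) conj(g(s⁻¹x)) ds = ⟨h|g⟩ f(x).
-- Since an L²-valued integral has no pointwise values, the identity is tested on a dense set of
-- vectors h and against a dense set of η, where Fubini for continuous compactly supported functions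
-- applies.
theorem integratedForm_thetaFun (f g : C_c(G, ℂ)) :
    (translationRep G μ).integratedForm (ConvAlg.ofProd μ (thetaFun f g)) =
      InnerProductSpace.rankOne ℂ (toL2 μ f) (toL2 μ g) := by
  refine ContinuousLinearMap.ext fun ξ => ?_
  refine (denseRange_toL2 μ).induction_on (p := fun ξ => (translationRep G μ).integratedForm
    (ConvAlg.ofProd μ (thetaFun f g)) ξ = InnerProductSpace.rankOne ℂ (toL2 μ f) (toL2 μ g) ξ) ξ
    (isClosed_eq (by fun_prop) (by fun_prop)) fun h => ?_
  refine (denseRange_toL2 μ).eq_of_inner_right ℂ fun η => ?_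
  have hf := map_continuous f
  have hg := map_continuous g
  have hh := map_continuous h
  have hη := map_continuous η
  rw [CovariantRep.inner_integratedForm,
    InnerProductSpace.rankOne_apply, inner_smul_right, inner_toL2, inner_toL2, ← integral_const_mul]
  have h1 (s : G) : inner ℂ (toL2 μ η) ((translationRep G μ).rep (ConvAlg.ofProd μ (thetaFun f g) s)
      ((translationRep G μ).unitary s (toL2 μ h))) =
      ∫ x, (f x * conj (η x)) * (h (s⁻¹ * x) * conj (g (s⁻¹ * x))) ∂μ := by
    rw [L2.inner_def]
    refine integral_congr_ae ?_
    filter_upwards [coeFn_toL2 μ η,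
      coeFn_translationRep μ s (ConvAlg.ofProd μ (thetaFun f g) s) (toL2 μ h),
      (measurePreserving_smul s⁻¹ μ).quasiMeasurePreserving.ae_eq (coeFn_toL2 μ h)]
      with x hx1 hx2 hx3
    have hx4 : toL2 μ h (s⁻¹ • x) = h (s⁻¹ * x) := hx3
    have hx5 : ConvAlg.ofProd μ (thetaFun f g) s x = f x * conj (g (s⁻¹ * x)) := rfl
    rw [hx1, hx2, hx4, hx5, RCLike.inner_apply]
    ring
  simp_rw [h1]
  rw [integral_integral_swap_of_hasCompactSupport]
  · refine integral_congr_ae (ae_of_all _ fun x => ?_)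
    simp only
    rw [integral_const_mul, integral_inv_mul_right_eq_self (fun y => h y * conj (g y)), mul_comm]
  · fun_prop
  -- With x ∈ supp f and s⁻¹x ∈ supp h, one has s = x(s⁻¹x)⁻¹ ∈ supp f · (supp h)⁻¹.
  · refine HasCompactSupport.of_support_subset_isCompact
      (K := (tsupport f * (tsupport h)⁻¹) ×ˢ tsupport f)
      ((f.hasCompactSupport.isCompact.mul h.hasCompactSupport.isCompact.inv).prod
        f.hasCompactSupport) ?_
    rintro ⟨s, x⟩ hsx
    have h2 : f x ≠ 0 := fun h0 => hsx (by simp [Function.uncurry, h0])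
    have h3 : h (s⁻¹ * x) ≠ 0 := fun h0 => hsx (by simp [Function.uncurry, h0])
    refine ⟨⟨x, subset_tsupport _ h2, (s⁻¹ * x)⁻¹, ?_, by simp⟩, subset_tsupport _ h2⟩
    simpa using subset_tsupport _ h3

end RegularRep

/-! ### Approximation in the crossed product -/

section Approximation

/-- The L¹ bound is imposed on each representation in the supremum. It lets approximation in the
crossed product be checked on functions. -/
theorem ConvAlg.norm_le_norm₁ {G : Type u} {A : Type v} [Group G] [TopologicalSpace G]
    [IsTopologicalGroup G] [LocallyCompactSpace G] [NonUnitalCStarAlgebra A] [MeasurableSpace G]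
    [BorelSpace G] {α : CStarAction G A} {μ : Measure G} [IsFiniteMeasureOnCompacts μ]
    (F : ConvAlg α μ) : ‖F‖ ≤ F.norm₁ :=
  norm_le_of_forall fun π => π.norm_hom_le F

/-- Uniform limits with supports in a common compact set are limits in the crossed product. -/
theorem coe_mem_of_uniform_approx {G : Type u} {A : Type v} [Group G] [TopologicalSpace G]
    [IsTopologicalGroup G] [LocallyCompactSpace G] [NonUnitalCStarAlgebra A] [MeasurableSpace G]
    [BorelSpace G] {α : CStarAction G A} {μ : Measure G} [IsFiniteMeasureOnCompacts μ]
    {S : Set (CrossedProduct α μ)} (hS : IsClosed S) {K : Set G} (hK : IsCompact K)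
    {F : ConvAlg α μ} (h : ∀ ε : ℝ, 0 < ε → ∃ D : ConvAlg α μ, (D : CrossedProduct α μ) ∈ S ∧
      (∀ s ∉ K, F s = D s) ∧ ∀ s, ‖F s - D s‖ ≤ ε) : (F : CrossedProduct α μ) ∈ S := by
  rw [← hS.closure_eq, Metric.mem_closure_iff]
  intro ε hε
  -- The added 1 keeps the denominator positive when K is null and makes the final inequality
  -- strict.
  have hc : 0 < ε / (μ.real K + 1) := by positivity
  obtain ⟨D, hD, hsupp, hle⟩ := h _ hc
  refine ⟨_, hD, ?_⟩
  rw [dist_eq_norm, ← UniformSpace.Completion.coe_sub, UniformSpace.Completion.norm_coe]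
  calc ‖F - D‖ ≤ (F - D).norm₁ := ConvAlg.norm_le_norm₁ _
    _ = ∫ s in K, ‖(F - D) s‖ ∂μ := by
      refine (setIntegral_eq_integral_of_forall_compl_eq_zero fun s hs => ?_).symm
      change ‖F s - D s‖ = 0
      rw [hsupp s hs, sub_self, norm_zero]
    _ ≤ ε / (μ.real K + 1) * μ.real K :=
      (Real.le_norm_self _).trans (norm_setIntegral_le_of_norm_le_const hK.measure_lt_top
        fun s _ => by rw [norm_norm]; exact hle s)
    _ < ε := by
      rw [div_mul_eq_mul_div, div_lt_iff₀ (by positivity)]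
      nlinarith [measureReal_nonneg (μ := μ) (s := K)]

variable {X E : Type*} [TopologicalSpace X]

/-- A compactly supported continuous family in `C₀(X)` is uniformly small off a compact set. -/
theorem exists_isCompact_norm_apply_le {Y : Type*} [TopologicalSpace Y] {F : Y → C₀(X, ℂ)}
    (hF : Continuous F) {K : Set Y} (hK : IsCompact K) {ε : ℝ} (hε : 0 < ε) :
    ∃ L : Set X, IsCompact L ∧ ∀ s ∈ K, ∀ x ∉ L, ‖F s x‖ ≤ ε := by
  refine hK.induction_on (p := fun K => ∃ L : Set X, IsCompact L ∧ ∀ s ∈ K, ∀ x ∉ L, ‖F s x‖ ≤ ε)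
    ⟨∅, isCompact_empty, by simp⟩ ?_ ?_ ?_
  · rintro s t hst ⟨L, hL, h⟩
    exact ⟨L, hL, fun y hy => h y (hst hy)⟩
  · rintro s t ⟨L, hL, h⟩ ⟨L', hL', h'⟩
    refine ⟨L ∪ L', hL.union hL', fun y hy x hx => ?_⟩
    rw [Set.mem_union, not_or] at hx
    exact hy.elim (fun hy => h y hy x hx.1) (fun hy => h' y hy x hx.2)
  -- Locally, the compact set that controls F s up to ε/2 serves every t with ‖F t - F s‖ < ε/2.
  · intro s _
    have h1 : ∀ᶠ x in cocompact X, ‖F s x‖ < ε / 2 := by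
      have := (F s).zero_at_infty'.norm
      rw [norm_zero] at this
      exact this.eventually_lt_const (by positivity)
    obtain ⟨L, hL, hLs⟩ := mem_cocompact.1 h1
    have h2 : ∀ᶠ t in 𝓝 s, ‖F t - F s‖ < ε / 2 := by
      have : IsOpen {t | ‖F t - F s‖ < ε / 2} := isOpen_lt (by fun_prop) continuous_const
      exact this.mem_nhds (by simpa using hε)
    refine ⟨_, mem_nhdsWithin_of_mem_nhds h2, L, hL, fun t ht x hx => ?_⟩
    have h3 : ‖F t x - F s x‖ ≤ ‖F t - F s‖ := (F t - F s).toBCF.norm_coe_le_norm x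
    have h4 : ‖F t x‖ ≤ ‖F t x - F s x‖ + ‖F s x‖ := by
      simpa using norm_add_le (F t x - F s x) (F s x)
    have h5 : ‖F s x‖ < ε / 2 := hLs hx
    have h6 : ‖F t - F s‖ < ε / 2 := ht
    linarith

variable [T2Space X] [LocallyCompactSpace X]

/-- Approximation of `χ • f` by functions of finite rank. -/
theorem exists_sum_smul_approx [NormedAddCommGroup E] [NormedSpace ℂ E] {f : X → E}
    (hf : Continuous f) (χ : C_c(X, ℂ)) (hχ : ∀ x, ‖χ x‖ ≤ 1) {ε : ℝ} (hε : 0 < ε) :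
    ∃ (n : ℕ) (φ : Fin n → C_c(X, ℂ)) (p : Fin n → X),
      (∀ i x, x ∉ tsupport χ → φ i x = 0) ∧ (∀ i, p i ∈ tsupport χ) ∧
      ∀ x, ‖χ x • f x - ∑ i, φ i x • f (p i)‖ ≤ ε := by
  -- The support of χ is covered by finitely many sets on which f stays within ε of its value at a
  -- point p. The coefficients are φᵢ = χψᵢ, for a partition of unity ψ subordinate to the cover.
  obtain ⟨t, htK, htc⟩ := χ.hasCompactSupport.isCompact.elim_nhds_subcover
    (fun p => {x | ‖f x - f p‖ < ε}) fun p _ => by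
      have : IsOpen {x | ‖f x - f p‖ < ε} :=
        isOpen_lt (by fun_prop) continuous_const
      exact this.mem_nhds (by simpa using hε)
  let e := t.equivFin
  let p : Fin t.card → X := fun i => e.symm i
  obtain ⟨ψ, hψs, hψ1, hψI, -⟩ := exists_continuous_sum_one_of_isOpen_isCompact
    (s := fun i => {x | ‖f x - f (p i)‖ < ε})
    (fun i => isOpen_lt (by fun_prop) continuous_const) χ.hasCompactSupport.isCompact fun x hx => by
      obtain ⟨y, hy, hxy⟩ := Set.mem_iUnion₂.1 (htc hx)
      exact Set.mem_iUnion.2 ⟨e ⟨y, hy⟩, by simpa [p] using hxy⟩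
  refine ⟨t.card, fun i => ⟨⟨fun x => χ x * (ψ i x : ℂ), by fun_prop⟩,
    χ.hasCompactSupport.mul_right⟩, p, fun i x hx => ?_, fun i => htK _ (e.symm i).2, fun x => ?_⟩
  · change χ x * (ψ i x : ℂ) = 0
    rw [image_eq_zero_of_notMem_tsupport hx, zero_mul]
  · change ‖χ x • f x - ∑ i, (χ x * (ψ i x : ℂ)) • f (p i)‖ ≤ ε
    by_cases hx : x ∈ tsupport χ
    · have h1 : ∑ i, ψ i x = 1 := by simpa using hψ1 hx
      have h2 : χ x • f x - ∑ i, (χ x * (ψ i x : ℂ)) • f (p i)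
          = χ x • ∑ i, (ψ i x : ℂ) • (f x - f (p i)) := by
        simp_rw [smul_sub, Finset.sum_sub_distrib, ← Finset.sum_smul, ← Complex.ofReal_sum, h1,
          Complex.ofReal_one, one_smul, smul_sub, Finset.smul_sum, smul_smul]
      rw [h2, norm_smul]
      calc ‖χ x‖ * ‖∑ i, (ψ i x : ℂ) • (f x - f (p i))‖
          ≤ 1 * ∑ i, ψ i x * ε := by
            refine mul_le_mul (hχ x) ((norm_sum_le _ _).trans (Finset.sum_le_sum fun i _ => ?_))
              (norm_nonneg _) zero_le_one
            rw [norm_smul, Complex.norm_real, Real.norm_of_nonneg (hψI i x).1]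
            -- Where ψᵢ does not vanish, x lies in the i-th set, so f x is within ε of f (p i).
            by_cases h : ψ i x = 0
            · simp [h]
            · exact mul_le_mul_of_nonneg_left
                (le_of_lt (hψs i (subset_tsupport _ h))) (hψI i x).1
        _ = ε := by rw [one_mul, ← Finset.sum_mul, h1, one_mul]
    · simpa [image_eq_zero_of_notMem_tsupport hx] using hε.le

end Approximation

/-! ### Pointwise evaluation -/

theorem ConvAlg.sum_apply {G : Type u} {A : Type v} [Group G] [TopologicalSpace G]
    [MeasurableSpace G] [NonUnitalCStarAlgebra A] {α : CStarAction G A}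
    {μ : Measure G} {ι : Type*} (t : Finset ι) (F : ι → ConvAlg α μ) (s : G) :
    (∑ i ∈ t, F i) s = ∑ i ∈ t, F i s :=
  map_sum (⟨⟨fun F : ConvAlg α μ => F s, rfl⟩, fun _ _ => rfl⟩ : ConvAlg α μ →+ A) F t

/-- Point evaluation is a bounded functional, so it commutes with the Bochner integral. Convolutions
in C_c(G, C₀(X)) thus become scalar integrals. -/
theorem zeroAtInfty_integral_apply {Y X : Type*} [TopologicalSpace X] [MeasurableSpace Y]
    {ν : Measure Y} {F : Y → C₀(X, ℂ)} (hF : Integrable F ν) (x : X) :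
    (∫ y, F y ∂ν) x = ∫ y, F y x ∂ν := by
  let ev : C₀(X, ℂ) →L[ℂ] ℂ := LinearMap.mkContinuous
    { toFun := fun f => f x
      map_add' := fun _ _ => rfl
      map_smul' := fun _ _ => rfl } 1 fun f => by
        rw [one_mul]
        exact f.toBCF.norm_coe_le_norm x
  exact (ev.integral_comp_comm hF).symm

theorem zeroAtInfty_sum_apply {X ι : Type*} [TopologicalSpace X] (t : Finset ι)
    (F : ι → C₀(X, ℂ)) (x : X) : (∑ i ∈ t, F i) x = ∑ i ∈ t, F i x :=
  map_sum (⟨⟨fun F : C₀(X, ℂ) => F x, rfl⟩, fun _ _ => rfl⟩ : C₀(X, ℂ) →+ ℂ) F t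

theorem continuous_zeroAtInfty_eval {X Y : Type*} [TopologicalSpace X] [TopologicalSpace Y]
    {F : Y → C₀(X, ℂ)} (hF : Continuous F) {h : Y → X} (hh : Continuous h) :
    Continuous fun y => F y (h y) := by
  have h1 : Continuous fun y => (F y).toBCF :=
    ZeroAtInftyContinuousMap.isometry_toBCF.continuous.comp hF
  exact h1.eval hh

/-- A compactly supported function as an element of `C₀`. -/
def ccToZeroAtInfty {X : Type*} [TopologicalSpace X] (f : C_c(X, ℂ)) : C₀(X, ℂ) where
  toContinuousMap := f.toContinuousMap
  zero_at_infty' := f.hasCompactSupport.is_zero_at_infty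

/-! ### Elements of C_c(G, C₀(G)) as kernels in (x, y), with s = xy⁻¹ -/

section Kernel

variable {G : Type u} [Group G] [TopologicalSpace G] [IsTopologicalGroup G] [LocallyCompactSpace G]
  [MeasurableSpace G] {μ : Measure G}

/-- The function `y ↦ F (x y⁻¹) x`. -/
def ConvAlg.kernelRow (F : ConvAlg (translationAction G G) μ) (x : G) : C_c(G, ℂ) where
  toFun y := F (x * y⁻¹) x
  continuous_toFun := continuous_zeroAtInfty_eval (F.continuous.comp (by fun_prop)) continuous_const
  hasCompactSupport' := by
    refine HasCompactSupport.of_support_subset_isCompact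
      (F.hasCompactSupport.isCompact.image (f := fun s => s⁻¹ * x) (by fun_prop)) fun y hy => ?_
    refine ⟨x * y⁻¹, subset_tsupport _ fun h => hy ?_, by simp⟩
    simp [h]

theorem ConvAlg.kernelRow_apply (F : ConvAlg (translationAction G G) μ) (x y : G) :
    F.kernelRow x y = F (x * y⁻¹) x := rfl

open scoped Pointwise in
-- For x in a compact neighbourhood N all rows live on the compact set (supp F)⁻¹ N, so joint
-- continuity upgrades to continuity in the sup norm.
theorem ConvAlg.continuous_kernelRow (F : ConvAlg (translationAction G G) μ) :
    Continuous fun x => ccToZeroAtInfty (F.kernelRow x) := by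
  refine continuous_family_zeroAtInfty ?_ ?_
  · exact continuous_zeroAtInfty_eval
      (F.continuous.comp (by fun_prop : Continuous fun p : G × G => p.1 * p.2⁻¹)) continuous_fst
  · intro x₀ ε hε
    obtain ⟨N, hN, hNs⟩ := exists_compact_mem_nhds x₀
    refine ⟨(tsupport F)⁻¹ * N, F.hasCompactSupport.isCompact.inv.mul hN, ?_⟩
    filter_upwards [hNs] with x hx y hy
    have h : F (x * y⁻¹) = 0 := image_eq_zero_of_notMem_tsupport fun h =>
      hy ⟨(x * y⁻¹)⁻¹, by simpa using h, x, hx, by simp⟩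
    change ‖F (x * y⁻¹) x‖ ≤ ε
    simpa [h] using hε.le

end Kernel

/-! ### The elements `θ̃_{f,g}` -/

section Theta

variable {G : Type u} [Group G] [TopologicalSpace G] [IsTopologicalGroup G] [LocallyCompactSpace G]
  [MeasurableSpace G] [BorelSpace G]

/-- Since (t⁻¹s)⁻¹(t⁻¹x) = s⁻¹x, the factors f₁(x) and conj(g₂(s⁻¹x)) do not depend on the
integration variable t. What remains under the integral is f₂ conj(g₁) at t⁻¹x. -/
theorem thetaElt_mul_thetaElt (μ : Measure G) [IsFiniteMeasureOnCompacts μ]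
    [μ.IsMulRightInvariant] [μ.IsInvInvariant] (f₁ g₁ f₂ g₂ : C_c(G, ℂ)) :
    thetaElt μ f₁ g₁ * thetaElt μ f₂ g₂ =
      (∫ x, f₂ x * conj (g₁ x) ∂μ) • thetaElt μ f₁ g₂ := by
  rw [thetaElt, thetaElt, thetaElt, ← CrossedProduct.coe_mul, ← UniformSpace.Completion.coe_smul]
  congr 1
  ext s x
  have h (t : G) : (ConvAlg.ofProd μ (thetaFun f₁ g₁) t * (translationAction G G).aut t
      (ConvAlg.ofProd μ (thetaFun f₂ g₂) (t⁻¹ * s))) x =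
      (f₁ x * conj (g₂ (s⁻¹ * x))) * (f₂ (t⁻¹ * x) * conj (g₁ (t⁻¹ * x))) := by
    change (f₁ x * conj (g₁ (t⁻¹ * x))) *
      (f₂ (t⁻¹ * x) * conj (g₂ ((t⁻¹ * s)⁻¹ * (t⁻¹ * x)))) = _
    rw [mul_inv_rev, inv_inv, mul_assoc s⁻¹, mul_inv_cancel_left]
    ring
  rw [ConvAlg.mul_apply, zeroAtInfty_integral_apply (ConvAlg.integrable_integrand _ _ s)]
  simp_rw [h]
  rw [integral_const_mul, integral_inv_mul_right_eq_self (fun y => f₂ y * conj (g₁ y)), mul_comm]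
  rfl

theorem star_thetaElt (hG : IsUnimodular G) (μ : Measure G) [IsFiniteMeasureOnCompacts μ]
    (f g : C_c(G, ℂ)) : star (thetaElt μ f g) = thetaElt μ g f := by
  rw [thetaElt, thetaElt, ← CrossedProduct.coe_star]
  congr 1
  ext s x
  rw [ConvAlg.star_apply, hG, Complex.ofReal_one, one_smul]
  change conj (f (s⁻¹ * x) * conj (g ((s⁻¹)⁻¹ * (s⁻¹ * x)))) = g x * conj (f (s⁻¹ * x))
  rw [inv_inv, mul_inv_cancel_left, map_mul, Complex.conj_conj, mul_comm]

variable {μ : Measure G} [T2Space G] [IsFiniteMeasureOnCompacts μ]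

variable (μ) in
/-- The linear span of the elements `θ̃_{f,g}`. -/
def thetaSpan : Submodule ℂ (CrossedProduct (translationAction G G) μ) :=
  Submodule.span ℂ {a | ∃ f g : C_c(G, ℂ), a = thetaElt μ f g}

/-- The product of a function `F` with values in `A` and a multiplier `a : A`. -/
def ConvAlg.leftMul {A : Type v} [NonUnitalCStarAlgebra A] {α : CStarAction G A} (a : A)
    (F : ConvAlg α μ) : ConvAlg α μ :=
  mk (fun s => a * F s) (continuous_const.mul F.continuous) F.hasCompactSupport.mul_left

open scoped Pointwise in
-- In kernel form, χF is x ↦ χ(x) · (row of F at x), a cut-off continuous map into C₀(G). A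
-- finite-rank approximation Σ φᵢ(x) · (row at pᵢ) of it is exactly a sum of kernels of elements θ̃,
-- and the error is uniform in (x, y), hence in (x, s).
theorem coe_leftMul_mem_closure_thetaSpan (χ : C_c(G, ℂ)) (hχ : ∀ x, ‖χ x‖ ≤ 1)
    (F : ConvAlg (translationAction G G) μ) :
    ((F.leftMul (ccToZeroAtInfty χ) : ConvAlg (translationAction G G) μ) :
      CrossedProduct (translationAction G G) μ) ∈
      closure (thetaSpan μ : Set (CrossedProduct (translationAction G G) μ)) := by
  refine coe_mem_of_uniform_approx isClosed_closure
    -- The approximant is nonzero at (x, s) only if x ∈ supp χ and y = s⁻¹x lies in (supp F)⁻¹ ·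
    -- supp χ, where some row at pᵢ ∈ supp χ lives. Then s = xy⁻¹ lies in the second set.
    (K := tsupport F ∪ tsupport χ * ((tsupport F)⁻¹ * tsupport χ)⁻¹)
    (F.hasCompactSupport.isCompact.union (χ.hasCompactSupport.isCompact.mul
      (F.hasCompactSupport.isCompact.inv.mul χ.hasCompactSupport.isCompact).inv)) fun ε hε => ?_
  obtain ⟨n, φ, p, hφ, hp, hle⟩ := exists_sum_smul_approx F.continuous_kernelRow χ hχ hε
  -- The conjugate compensates for the conjugation of the second argument in θ̃.
  let g (i : Fin n) : C_c(G, ℂ) := star (F.kernelRow (p i))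
  have hval (s x : G) (i : Fin n) : ConvAlg.ofProd μ (thetaFun (φ i) (g i)) s x =
      φ i x * F.kernelRow (p i) (s⁻¹ * x) := by
    change φ i x * conj (conj (F.kernelRow (p i) (s⁻¹ * x))) = _
    rw [Complex.conj_conj]
  refine ⟨∑ i, ConvAlg.ofProd μ (thetaFun (φ i) (g i)), ?_, fun s hs => ?_, fun s => ?_⟩
  · refine subset_closure ?_
    have : ((∑ i, ConvAlg.ofProd μ (thetaFun (φ i) (g i)) : ConvAlg (translationAction G G) μ) :
        CrossedProduct (translationAction G G) μ) = ∑ i, thetaElt μ (φ i) (g i) :=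
      map_sum (UniformSpace.Completion.toCompl :
        ConvAlg (translationAction G G) μ →+ CrossedProduct (translationAction G G) μ) _ _
    rw [this]
    exact Submodule.sum_mem _ fun i _ => Submodule.subset_span ⟨_, _, rfl⟩
  · rw [Set.mem_union, not_or] at hs
    have h1 : F.leftMul (ccToZeroAtInfty χ) s = 0 := by
      change _ * F s = 0
      rw [image_eq_zero_of_notMem_tsupport hs.1, mul_zero]
    rw [h1, ConvAlg.sum_apply, eq_comm]
    refine Finset.sum_eq_zero fun i _ => ?_
    ext x
    rw [hval]
    by_cases hx : x ∈ tsupport χ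
    · have : F (p i * (s⁻¹ * x)⁻¹) = 0 := image_eq_zero_of_notMem_tsupport fun h =>
        hs.2 ⟨x, hx, (s⁻¹ * x)⁻¹, Set.inv_mem_inv.2
          ⟨(p i * (s⁻¹ * x)⁻¹)⁻¹, Set.inv_mem_inv.2 h, p i, hp i, by simp⟩, by simp⟩
      rw [ConvAlg.kernelRow_apply, this]
      simp
    · rw [hφ i x hx, zero_mul]
      rfl
  · rw [← ZeroAtInftyContinuousMap.norm_toBCF_eq_norm,
      BoundedContinuousFunction.norm_le hε.le]
    intro x
    -- The error at (s, x) is the error of the rows at x, evaluated at y = s⁻¹x.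
    have h2 : (χ x • ccToZeroAtInfty (F.kernelRow x) -
        ∑ i, φ i x • ccToZeroAtInfty (F.kernelRow (p i))) (s⁻¹ * x) =
        (F.leftMul (ccToZeroAtInfty χ) s - (∑ i, ConvAlg.ofProd μ (thetaFun (φ i) (g i))) s) x := by
      rw [ConvAlg.sum_apply, ZeroAtInftyContinuousMap.sub_apply, ZeroAtInftyContinuousMap.sub_apply,
        zeroAtInfty_sum_apply, zeroAtInfty_sum_apply]
      congr 1
      · change χ x * F (x * (s⁻¹ * x)⁻¹) x = χ x * F s x
        simp
      · exact Finset.sum_congr rfl fun i _ => (hval s x i).symm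
    change ‖(F.leftMul (ccToZeroAtInfty χ) s -
      (∑ i, ConvAlg.ofProd μ (thetaFun (φ i) (g i))) s) x‖ ≤ ε
    rw [← h2]
    exact (BoundedContinuousFunction.norm_coe_le_norm
      (ZeroAtInftyContinuousMap.toBCF _) (s⁻¹ * x)).trans (hle x)

/-- All values F(s) are at most ε off one compact L, because s effectively ranges over the compact
support of F. A cutoff χ equal to 1 on L therefore moves F by at most ε without enlarging its
support in s, and χF is already in the closure. -/
theorem dense_thetaSpan :
    Dense (thetaSpan μ : Set (CrossedProduct (translationAction G G) μ)) := by
  intro a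
  induction a using UniformSpace.Completion.induction_on with
  | hp => exact isClosed_closure
  | ih F =>
    refine coe_mem_of_uniform_approx isClosed_closure F.hasCompactSupport.isCompact fun ε hε => ?_
    obtain ⟨L, hL, hFL⟩ :=
      exists_isCompact_norm_apply_le F.continuous F.hasCompactSupport.isCompact hε
    obtain ⟨χ, hχ1, -, hχc, hχI⟩ := exists_continuous_one_zero_of_isCompact hL isClosed_empty
      (Set.disjoint_empty L)
    let χ' : C_c(G, ℂ) := ⟨⟨fun x => (χ x : ℂ), by fun_prop⟩,
      hχc.comp_left (g := Complex.ofReal) Complex.ofReal_zero⟩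
    refine ⟨F.leftMul (ccToZeroAtInfty χ'), coe_leftMul_mem_closure_thetaSpan χ' (fun x => ?_) F,
      fun s hs => ?_, fun s => ?_⟩
    · change ‖(χ x : ℂ)‖ ≤ 1
      rw [Complex.norm_real, Real.norm_of_nonneg (hχI x).1]
      exact (hχI x).2
    · change F s = _ * F s
      rw [image_eq_zero_of_notMem_tsupport hs, mul_zero]
    · rw [← ZeroAtInftyContinuousMap.norm_toBCF_eq_norm, BoundedContinuousFunction.norm_le hε.le]
      intro x
      change ‖F s x - (χ x : ℂ) * F s x‖ ≤ ε
      by_cases hx : x ∈ L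
      · have : χ x = 1 := hχ1 hx
        simpa [this] using hε.le
      · have h1 : F s x - (χ x : ℂ) * F s x = ((1 - χ x : ℝ) : ℂ) * F s x := by
          push_cast; ring
        have h2 : ‖F s x‖ ≤ ε := by
          by_cases hs : s ∈ tsupport F
          · exact hFL s hs x hx
          · rw [image_eq_zero_of_notMem_tsupport hs]
            simpa using hε.le
        rw [h1, norm_mul, Complex.norm_real, Real.norm_of_nonneg (by linarith [(hχI x).2])]
        nlinarith [(hχI x).1, norm_nonneg (F s x), (hχI x).2]

end Theta

/-! ### Extension of representations to the crossed product -/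

section Extension

variable {G : Type u} {A : Type v} [Group G] [TopologicalSpace G] [IsTopologicalGroup G]
  [LocallyCompactSpace G] [NonUnitalCStarAlgebra A] [MeasurableSpace G] [BorelSpace G]
  {α : CStarAction G A} {μ : Measure G} [IsFiniteMeasureOnCompacts μ]

namespace BoundedRep

open UniformSpace

theorem uniformContinuous_hom (π : BoundedRep α μ) : UniformContinuous π.hom := by
  refine LipschitzWith.uniformContinuous (K := 1) (LipschitzWith.of_dist_le_mul fun F K => ?_)
  rw [dist_eq_norm, dist_eq_norm, NNReal.coe_one, one_mul, ← map_sub]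
  exact ConvAlg.norm_hom_le_norm π _

/-- The representation of the crossed product extending a representation of `C_c(G, A)`. -/
def extend (π : BoundedRep α μ) : CrossedProduct α μ →⋆ₙₐ[ℂ] (π.H →L[ℂ] π.H) :=
  have hc : Continuous (Completion.extension π.hom) := Completion.continuous_extension
  have he (F : ConvAlg α μ) : Completion.extension π.hom F = π.hom F :=
    Completion.extension_coe π.uniformContinuous_hom F
  { toFun := Completion.extension π.hom
    map_smul' := fun c a => by
      induction a using Completion.induction_on with
      | hp => exact isClosed_eq (hc.comp (continuous_const_smul c)) (hc.const_smul c)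
      | ih F =>
        rw [← Completion.coe_smul, he, he, map_smul]
        rfl
    map_zero' := by rw [← Completion.coe_zero, he, map_zero]
    map_add' := fun a b => by
      induction a, b using Completion.induction_on₂ with
      | hp => exact isClosed_eq (by fun_prop) (by fun_prop)
      | ih F K => rw [← Completion.coe_add, he, he, he, map_add]
    map_mul' := fun a b => by
      induction a, b using Completion.induction_on₂ with
      | hp => exact isClosed_eq (by fun_prop) (by fun_prop)
      | ih F K => rw [← CrossedProduct.coe_mul, he, he, he, map_mul]
    map_star' := fun a => by
      induction a using Completion.induction_on with
      | hp => exact isClosed_eq (by fun_prop) (by fun_prop)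
      | ih F => rw [← CrossedProduct.coe_star, he, he, map_star] }

theorem extend_coe (π : BoundedRep α μ) (F : ConvAlg α μ) : π.extend F = π.hom F :=
  Completion.extension_coe π.uniformContinuous_hom F

theorem continuous_extend (π : BoundedRep α μ) : Continuous π.extend :=
  Completion.continuous_extension

end BoundedRep

end Extension

/-! ### Compact operators and operators of finite rank -/

section FiniteRank

variable {H : Type*} [NormedAddCommGroup H] [InnerProductSpace ℂ H]

theorem isCompactOperator_rankOne (x y : H) :
    IsCompactOperator (InnerProductSpace.rankOne ℂ x y : H →L[ℂ] H) := by
  rw [InnerProductSpace.rankOne_def']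
  exact (isCompactOperator_of_locallyCompactSpace_rng
    (ContinuousLinearMap.toSpanSingleton ℂ x)).comp_clm (innerSL ℂ y)

/-- The compact operators on a Hilbert space are limits of operators of finite rank. -/
theorem IsCompactOperator.mem_closure_span_rankOne [CompleteSpace H] {T : H →L[ℂ] H}
    (hT : IsCompactOperator T) : T ∈ closure (Submodule.span ℂ
      {S : H →L[ℂ] H | ∃ x y : H, S = InnerProductSpace.rankOne ℂ x y} : Set (H →L[ℂ] H)) := by
  rw [Metric.mem_closure_iff]
  intro ε hε
  have hTK := (isCompactOperator_iff_isCompact_closure_image_closedBall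
    (T : H →ₗ[ℂ] H) zero_lt_one).1 hT
  obtain ⟨t, -, htf, htc⟩ := Metric.finite_approx_of_totallyBounded
    (hTK.totallyBounded.subset subset_closure) (ε / 2) (by positivity)
  -- The points of t form a finite ε/2-net for the image of the unit ball. Projecting onto their
  -- span gives a finite-rank operator, and the projection of T x is at least as close to T x as the
  -- nearest net point.
  let U : Submodule ℂ H := Submodule.span ℂ t
  have : FiniteDimensional ℂ U := FiniteDimensional.span_of_finite ℂ htf
  let b := stdOrthonormalBasis ℂ U
  refine ⟨U.starProjection ∘L T, ?_, ?_⟩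
  · rw [b.starProjection_eq_sum_rankOne, ContinuousLinearMap.finsetSum_comp]
    refine Submodule.sum_mem _ fun i _ => Submodule.subset_span ⟨b i, T.adjoint (b i), ?_⟩
    exact InnerProductSpace.rankOne_comp _ _ _
  · rw [dist_eq_norm]
    refine lt_of_le_of_lt ?_ (half_lt_self hε)
    refine ContinuousLinearMap.opNorm_le_of_unit_norm (by positivity) fun x hx => ?_
    obtain ⟨y, hy, hxy⟩ := Set.mem_iUnion₂.1 (htc ⟨x, by simp [hx], rfl⟩)
    rw [Metric.mem_ball, dist_eq_norm] at hxy
    refine le_trans ?_ hxy.le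
    change ‖T x - U.starProjection (T x)‖ ≤ ‖T x - y‖
    rw [Submodule.starProjection_minimal]
    exact ciInf_le ⟨0, by rintro _ ⟨z, rfl⟩; exact norm_nonneg _⟩
      (⟨y, Submodule.subset_span hy⟩ : U)

theorem continuous_rankOne_left (y : H) :
    Continuous fun x : H => (InnerProductSpace.rankOne ℂ x y : H →L[ℂ] H) :=
  (InnerProductSpace.rankOne ℂ : H →L[ℂ] H →L⋆[ℂ] H →L[ℂ] H).continuous.eval_const y

theorem continuous_rankOne_right (x : H) :
    Continuous fun y : H => (InnerProductSpace.rankOne ℂ x y : H →L[ℂ] H) :=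
  (InnerProductSpace.rankOne ℂ x : H →L⋆[ℂ] H →L[ℂ] H).continuous

/-- Separate continuity in the two vectors suffices: the dense family is completed in one variable
at a time. -/
theorem rankOne_mem_of_denseRange {ι : Type*} {e : ι → H} (he : DenseRange e)
    {S : Set (H →L[ℂ] H)} (hS : IsClosed S)
    (h : ∀ i j, InnerProductSpace.rankOne ℂ (e i) (e j) ∈ S) (x y : H) :
    InnerProductSpace.rankOne ℂ x y ∈ S := by
  refine he.induction_on (p := fun y => InnerProductSpace.rankOne ℂ x y ∈ S) y
    (hS.preimage (continuous_rankOne_right x)) fun j => ?_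
  exact he.induction_on (p := fun x => InnerProductSpace.rankOne ℂ x (e j) ∈ S) x
    (hS.preimage (continuous_rankOne_left (e j))) fun i => h i j

end FiniteRank

/-- An element of a C⋆-algebra that is annihilated from both sides by a total set is zero. -/
theorem eq_zero_of_mul_mul_eq_zero {A : Type*} [NonUnitalCStarAlgebra A] {S : Set A}
    (hS : Dense (Submodule.span ℂ S : Set A)) {a : A} (h : ∀ b ∈ S, ∀ c ∈ S, b * a * c = 0) :
    a = 0 := by
  let L := ContinuousLinearMap.mul ℂ A
  -- Density extends the vanishing of bac first to all c and then to all b. Taking b = a⋆ and c =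
  -- a⋆a gives (a⋆a)⋆(a⋆a) = 0, and the C⋆-identity is used twice.
  have h1 (b) (hb : b ∈ S) : L (b * a) = 0 :=
    ContinuousLinearMap.ext_on hS fun c hc => h b hb c hc
  have h2 (c : A) : L.flip (a * c) = 0 := ContinuousLinearMap.ext_on hS fun b hb => by
    have := DFunLike.congr_fun (h1 b hb) c
    exact (mul_assoc b a c).symm.trans this
  have h3 : star (star a * a) * (star a * a) = 0 := by
    have := DFunLike.congr_fun (h2 (star a * a)) (star a)
    rw [star_mul, star_star, mul_assoc]
    exact this
  exact CStarRing.star_mul_self_eq_zero_iff a |>.1 (CStarRing.star_mul_self_eq_zero_iff _ |>.1 h3)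

/-! ### The isomorphism with the compact operators -/

section StoneVonNeumann

variable {G : Type u} [Group G] [TopologicalSpace G] [IsTopologicalGroup G] [LocallyCompactSpace G]
  [SecondCountableTopology G] [T2Space G] [MeasurableSpace G] [BorelSpace G] (hG : IsUnimodular G)
  (μ : Measure G) [IsFiniteMeasureOnCompacts μ] [μ.IsMulLeftInvariant] [μ.IsInvInvariant]

/-- The representation of `C₀(G) ⋊ G` on `L²(G)` by multiplication and translation. -/
def regularRep : CrossedProduct (translationAction G G) μ →⋆ₙₐ[ℂ] (Lp ℂ 2 μ →L[ℂ] Lp ℂ 2 μ) :=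
  ((translationRep G μ).boundedRep hG μ).extend

theorem continuous_regularRep : Continuous (regularRep hG μ) :=
  ((translationRep G μ).boundedRep hG μ).continuous_extend

variable [μ.IsMulRightInvariant]

theorem regularRep_thetaElt (f g : C_c(G, ℂ)) : regularRep hG μ (thetaElt μ f g) =
    InnerProductSpace.rankOne ℂ (toL2 μ f) (toL2 μ g) :=
  (((translationRep G μ).boundedRep hG μ).extend_coe _).trans (integratedForm_thetaFun μ f g)

/-- The dense span of the θ̃ goes to finite-rank operators, and the compact operators are norm
closed. -/
theorem isCompactOperator_regularRep (a : CrossedProduct (translationAction G G) μ) :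
    IsCompactOperator (regularRep hG μ a) := by
  have hcl : IsClosed {a | regularRep hG μ a ∈ compactOperators (Lp ℂ 2 μ)} :=
    (inferInstance : IsClosed (compactOperators (Lp ℂ 2 μ) :
      Set (Lp ℂ 2 μ →L[ℂ] Lp ℂ 2 μ))).preimage (continuous_regularRep hG μ)
  refine hcl.closure_subset_iff.2 ?_ (dense_thetaSpan (μ := μ) a)
  intro b hb
  refine Submodule.span_induction (p := fun b _ => IsCompactOperator (regularRep hG μ b))
    ?_ ?_ ?_ ?_ hb
  · rintro _ ⟨f, g, rfl⟩
    rw [regularRep_thetaElt]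
    exact isCompactOperator_rankOne _ _
  · rw [map_zero]
    exact isCompactOperator_zero
  · intro b c _ _ h1 h2
    rw [map_add]
    exact h1.add h2
  · intro c b _ h
    rw [map_smul]
    exact h.smul c

/-- Both sides are linear and continuous in a, so it is enough to take a = θ̃_{f,g}, where the
product rule applied twice gives the scalar. The point is that the left side depends on a only
through its image under π. -/
theorem thetaElt_mul_mul_thetaElt (a : CrossedProduct (translationAction G G) μ)
    (f₁ g₁ f₂ g₂ : C_c(G, ℂ)) : thetaElt μ f₁ g₁ * a * thetaElt μ f₂ g₂ =
      (inner ℂ (toL2 μ g₁) (regularRep hG μ a (toL2 μ f₂)) : ℂ) • thetaElt μ f₁ g₂ := by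
  have hc := continuous_regularRep hG μ
  have hcl : IsClosed {a | thetaElt μ f₁ g₁ * a * thetaElt μ f₂ g₂ =
      (inner ℂ (toL2 μ g₁) (regularRep hG μ a (toL2 μ f₂)) : ℂ) • thetaElt μ f₁ g₂} :=
    isClosed_eq (by fun_prop) (by fun_prop)
  refine hcl.closure_subset_iff.2 ?_ (dense_thetaSpan (μ := μ) a)
  intro b hb
  refine Submodule.span_induction (p := fun b _ => thetaElt μ f₁ g₁ * b * thetaElt μ f₂ g₂ =
      (inner ℂ (toL2 μ g₁) (regularRep hG μ b (toL2 μ f₂)) : ℂ) • thetaElt μ f₁ g₂) ?_ ?_ ?_ ?_ hb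
  · rintro _ ⟨f, g, rfl⟩
    rw [thetaElt_mul_thetaElt, smul_mul_assoc, thetaElt_mul_thetaElt, regularRep_thetaElt,
      InnerProductSpace.rankOne_apply, inner_smul_right, inner_toL2, inner_toL2, smul_smul,
      mul_comm]
  · simp
  · intro b c _ _ h1 h2
    rw [mul_add, add_mul, h1, h2, map_add, _root_.add_apply, inner_add_right, add_smul]
  · intro c b _ h
    rw [mul_smul_comm, smul_mul_assoc, h, map_smul, _root_.smul_apply, inner_smul_right, smul_smul]

/-- If the image of a is zero, so is every product θ̃ a θ̃, and the θ̃ are total. -/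
theorem injective_regularRep : Function.Injective (regularRep hG μ) := by
  rw [injective_iff_map_eq_zero]
  intro a ha
  refine eq_zero_of_mul_mul_eq_zero (dense_thetaSpan (μ := μ)) ?_
  rintro _ ⟨f₁, g₁, rfl⟩ _ ⟨f₂, g₂, rfl⟩
  rw [thetaElt_mul_mul_thetaElt hG, ha, _root_.zero_apply, inner_zero_right, zero_smul]

/-- An injective ⋆-homomorphism between C⋆-algebras is isometric, so its range is complete. -/
theorem isClosed_range_regularRep : IsClosed (Set.range (regularRep hG μ)) := by
  have hi : Isometry (regularRep hG μ) := AddMonoidHomClass.isometry_of_norm _ fun a =>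
    NonUnitalStarAlgHom.norm_map _ (injective_regularRep hG μ) a
  exact hi.isClosedEmbedding.isClosed_range

theorem rankOne_mem_range_regularRep (ξ η : Lp ℂ 2 μ) :
    InnerProductSpace.rankOne ℂ ξ η ∈ Set.range (regularRep hG μ) :=
  rankOne_mem_of_denseRange (denseRange_toL2 μ) (isClosed_range_regularRep hG μ)
    (fun f g => ⟨_, regularRep_thetaElt hG μ f g⟩) ξ η

theorem IsCompactOperator.mem_range_regularRep {T : Lp ℂ 2 μ →L[ℂ] Lp ℂ 2 μ}
    (hT : IsCompactOperator T) : T ∈ Set.range (regularRep hG μ) := by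
  refine (isClosed_range_regularRep hG μ).closure_subset_iff.2 ?_ hT.mem_closure_span_rankOne
  -- The range is viewed as a linear subspace, so that containing the rank-one operators implies
  -- containing their span.
  refine Submodule.span_le (p := LinearMap.range
    (LinearMapClass.linearMap (regularRep hG μ))) |>.2 ?_
  rintro _ ⟨ξ, η, rfl⟩
  exact rankOne_mem_range_regularRep hG μ ξ η

/-- The isomorphism of `C₀(G) ⋊ G` with the compact operators on `L²(G)`. -/
def crossedProductEquivCompactOperators :
    CrossedProduct (translationAction G G) μ ≃⋆ₐ[ℂ] compactOperators (Lp ℂ 2 μ) :=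
  StarAlgEquiv.ofBijective
    (NonUnitalStarAlgHom.codRestrict (regularRep hG μ) (compactOperators (Lp ℂ 2 μ))
      (isCompactOperator_regularRep hG μ))
    ⟨(NonUnitalStarAlgHom.injective_codRestrict _ _ _).2 (injective_regularRep hG μ), fun T => by
      obtain ⟨a, ha⟩ := IsCompactOperator.mem_range_regularRep hG μ T.2
      exact ⟨a, Subtype.ext ha⟩⟩

end StoneVonNeumann

end

/-! ### The Stone–von Neumann theorem -/

theorem mainTheorem3 {G : Type*} [Group G] [TopologicalSpace G] [IsTopologicalGroup G]
    [LocallyCompactSpace G] [SecondCountableTopology G] [T2Space G]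
    [MeasurableSpace G] [BorelSpace G] (hG : IsUnimodular G)
    (μ : Measure G) [μ.IsHaarMeasure] :
    (∀ f₁ g₁ f₂ g₂ : C_c(G, ℂ), thetaElt μ f₁ g₁ * thetaElt μ f₂ g₂ =
      (∫ x, f₂ x * conj (g₁ x) ∂μ) • thetaElt μ f₁ g₂) ∧
    (∀ f g : C_c(G, ℂ), star (thetaElt μ f g) = thetaElt μ g f) ∧
    Dense (Submodule.span ℂ {a | ∃ f g : C_c(G, ℂ), a = thetaElt μ f g} :
      Set (CrossedProduct (translationAction G G) μ)) ∧
    ∃ Φ : CrossedProduct (translationAction G G) μ ≃⋆ₐ[ℂ] compactOperators (Lp ℂ 2 μ),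
      ∀ f g : C_c(G, ℂ), (Φ (thetaElt μ f g) : Lp ℂ 2 μ →L[ℂ] Lp ℂ 2 μ) =
        InnerProductSpace.rankOne ℂ (toL2 μ f) (toL2 μ g) := by
  -- Second countability makes the Haar measure inner regular, as the uniqueness arguments require.
  -- Right invariance and inversion invariance are all that the product formula and the
  -- representation need from unimodularity of μ.
  have : μ.IsMulRightInvariant := hG.isMulRightInvariant μ
  have : μ.IsInvInvariant := isInvInvariant_of_isMulRightInvariant μ
  exact ⟨thetaElt_mul_thetaElt μ, star_thetaElt hG μ, dense_thetaSpan,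
    crossedProductEquivCompactOperators hG μ, regularRep_thetaElt hG μ⟩
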